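/- Let $N\ge 3$ and let $m_1,\dots,m_N$ be nonzero real numbers (masses, of either sign) with $m_i+m_j\neq 0$ for all $i\ne j$. Put $M=\sum_{i} m_i$, let $B(y,z)=\sum_{i} y_i m_i z_i$ on $\mathbb R^N$, and let $P_0=\{x\in\mathbb R^N:\sum_i m_i x_i=0\}$. Consider $N$ point particles on the line with these masses, initially in any order. A solution on an open time interval $I\ne\emptyset$ is a function $x=(x_1,\dots,x_N)\colon I\to\mathbb R^N$ such that no three particles are at the same place at the same time, and every $t\in I$ has a left and a right neighbourhood on which all velocities are constant, with respective values $v$ and $w$ satisfying: $w_i=v_i$ if no other particle is at $x_i(t)$, and $w_i=(1-\mu_{ij})v_i+\mu_{ij}v_j$ with $\mu_{ij}=\frac{2m_j}{m_i+m_j}$ if $x_i(t)=x_j(t)$ for some $j\ne i$ (elastic collision; several pairs may collide simultaneously at different places). A solution is maximal if it does not extend to a solution on a strictly larger open interval. A collision is a time $t\in I$ together with a pair of particles that meet at time $t$ and were apart immediately before $t$. Then the following are equivalent: (a) the restriction $B|_{P_0}$ is definite (i.e. positive definite or negative definite); (b) $M\neq 0$ and every maximal solution has only finitely many collisions in total.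 -/

import Mathlib

open Set Filter Topology

namespace LineParticles

/-- The total mass `M`. -/
def totalMass {N : ℕ} (m : Fin N → ℝ) : ℝ := ∑ i, m i

/-- The kinetic energy form `B(y, z) = ∑ i, y i * m i * z i` on `ℝ^N`. -/
def kineticForm {N : ℕ} (m : Fin N → ℝ) : LinearMap.BilinForm ℝ (Fin N → ℝ) :=
  LinearMap.mk₂ ℝ (fun y z => ∑ i, y i * m i * z i)
    (fun y y' z => by simp [add_mul, Finset.sum_add_distrib])
    (fun c y z => by simp [Finset.mul_sum, mul_assoc])
    (fun y z z' => by simp [mul_add, Finset.sum_add_distrib])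
    (fun c y z => by simp [Finset.mul_sum, mul_left_comm])

/-- The subspace `P₀` of all `x` with `∑ i, m i * x i = 0`. -/
def zeroMomentum {N : ℕ} (m : Fin N → ℝ) : Submodule ℝ (Fin N → ℝ) where
  carrier := {x | ∑ i, m i * x i = 0}
  add_mem' := by
    intro a b ha hb
    change ∑ i, m i * a i = 0 at ha
    change ∑ i, m i * b i = 0 at hb
    change ∑ i, m i * (a + b) i = 0
    simp [mul_add, Finset.sum_add_distrib, ha, hb]
  zero_mem' := by simp
  smul_mem' := by
    intro c a ha
    change ∑ i, m i * a i = 0 at ha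
    change ∑ i, m i * (c • a) i = 0
    simp [mul_left_comm, ← Finset.mul_sum, ha]

/-- A bilinear form is definite if it is positive definite or negative definite. -/
def IsDefinite {V : Type*} [AddCommGroup V] [Module ℝ V] (B : LinearMap.BilinForm ℝ V) : Prop :=
  (∀ x : V, x ≠ 0 → 0 < B x x) ∨ (∀ x : V, x ≠ 0 → B x x < 0)

/-- The coefficient `μ i j = 2 m j / (m i + m j)` of an elastic collision. -/
noncomputable def collisionCoeff {N : ℕ} (m : Fin N → ℝ) (i j : Fin N) : ℝ :=
  2 * m j / (m i + m j)

/-- Incoming velocities `v` and outgoing velocities `w` at an instant at which the particles are at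
the positions `p`: particles at different places do not influence each other, and two particles at
the same place undergo an elastic collision (which changes nothing if their velocities agree).
For a pair `i, j` in contact, `meeting` is used for `(i, j)` and for `(j, i)`. -/
structure CollisionLaw {N : ℕ} (m p v w : Fin N → ℝ) : Prop where
  free : ∀ i, (∀ j, j ≠ i → p j ≠ p i) → w i = v i
  meeting : ∀ i j, i ≠ j → p i = p j →
    w i = (1 - collisionCoeff m i j) * v i + collisionCoeff m i j * v j

/-- `x` is a motion of the particles with masses `m` during the open time interval `I` (the values
of `x` outside `I` are irrelevant): three particles are never at the same place, and each instant
of `I` has a one-sided neighbourhood before it and one after it in which all velocities are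
constant, these velocities being related by the law of elastic collisions. The particles may be in
any order on the line, and several pairs may collide at the same instant at different places. -/
structure IsSolution {N : ℕ} (m : Fin N → ℝ) (I : Set ℝ) (x : ℝ → Fin N → ℝ) : Prop where
  isOpen : IsOpen I
  ordConnected : I.OrdConnected
  nonempty : I.Nonempty
  no_multiple : ∀ t ∈ I, ∀ i j k : Fin N, i ≠ j → j ≠ k → i ≠ k →
    ¬ (x t i = x t j ∧ x t j = x t k)
  motion : ∀ t ∈ I, ∃ v w : Fin N → ℝ,
    (∀ᶠ s in 𝓝[≤] t, x s = x t + (s - t) • v) ∧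
    (∀ᶠ s in 𝓝[≥] t, x s = x t + (s - t) • w) ∧
    CollisionLaw m (x t) v w

/-- A solution defined on a maximal time interval. -/
def IsMaximalSolution {N : ℕ} (m : Fin N → ℝ) (I : Set ℝ) (x : ℝ → Fin N → ℝ) : Prop :=
  IsSolution m I x ∧
    ∀ (J : Set ℝ) (y : ℝ → Fin N → ℝ), IsSolution m J y → I ⊆ J → EqOn y x I → J = I

/-- The collisions of a solution on `I`: all triples of a time `t ∈ I` and a pair of particles
`i < j` (the labels, not the positions, are compared) that meet at time `t` after having been apart
immediately before. -/
def collisions {N : ℕ} (I : Set ℝ) (x : ℝ → Fin N → ℝ) : Set (ℝ × Fin N × Fin N) :=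
  {c | c.1 ∈ I ∧ c.2.1 < c.2.2 ∧ x c.1 c.2.1 = x c.1 c.2.2 ∧
    ∀ᶠ s in 𝓝[<] c.1, x s c.2.1 ≠ x s c.2.2}

end LineParticles

/-! An elastic collision of $i$ and $j$ is the reflection, orthogonal for $B$, in the wall
$x_i=x_j$. It preserves $B$ and the momentum.

Definite implies finite. Changing the sign of all masses makes $B$ positive on $P_0$. Suppose
collisions accumulate at $T$ from the left. Let $W\subseteq P_0$ be spanned by the normals of the
walls hit infinitely often, and project $B$-orthogonally to $W$. Near $T$, the norms of the
projections of $u$ and of $x-(t-T)u$ are constant ($u$ is the velocity). Since velocities are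
bounded in $W$, the projection of $x$ tends to $0$, so the second norm is $0$. Then
$x_i-x_j=(t-T)(u_i-u_j)$ for the recurring pairs, and a collision at $t<T$ would have zero relative
velocity. Time reversal and the projective change $t\mapsto 1/t$ treat the other ends of time;
compactness concludes (`IsSolution.finite_collisionTimes`).

Indefinite implies infinite. If $M\ne0$ and the form is not definite, then up to a global sign one
negative mass is outweighed by a set of at least two positive ones (`isDefinite_of_forall_sum_le`).
Some of these particles can be ordered so that, after a possible sign change, every ordered
configuration has nonpositive energy relative to the center of mass (`Confining`). A generic motion
with zero momentum and positive energy unfolds to a straight line, on which this relative energy is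
quadratic with positive leading coefficient. Hence the motion must end in finite time. Genericity
rules out multiple collisions, so after finitely many collisions it could be continued; therefore
infinitely many occur (`Confining.exists_infinite`). The motion stays bounded above up to its end,
so the unused particles can rest far to the right. -/

namespace LineParticles

/-! ### Induction along an interval -/

/-- The set of $t$ such that `P` holds on $[a,t]$ is closed by `hl` and open to the right by `hr`.
-/
theorem forall_mem_Icc_of_local {P : ℝ → Prop} {a b : ℝ} (ha : P a)
    (hr : ∀ t, a ≤ t → t < b → P t → ∀ᶠ s in 𝓝[>] t, P s)
    (hl : ∀ t, a < t → t ≤ b → (∃ᶠ s in 𝓝[<] t, P s) → P t) : ∀ t ∈ Icc a b, P t := by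
  have key : Icc a b ⊆ {t | ∀ s ∈ Icc a t, P s} := by
    apply IsClosed.Icc_subset_of_forall_mem_nhdsWithin
    · refine isClosed_of_closure_subset fun t ht => ?_
      have htab : t ∈ Icc a b :=
        (isClosed_Icc.closure_subset_iff.2 inter_subset_right) ht
      refine ⟨fun s hs => ?_, htab⟩
      have hlt : ∀ s, a ≤ s → s < t → P s := fun s has hst => by
        obtain ⟨r, hr1, hr2⟩ := mem_closure_iff_nhds.1 ht _ (Ioi_mem_nhds hst)
        exact hr2.1 s ⟨has, le_of_lt hr1⟩
      rcases hs.2.lt_or_eq with h | h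
      · exact hlt s hs.1 h
      · subst h
        rcases hs.1.eq_or_lt with h | h
        · exact h ▸ ha
        · refine hl s h htab.2 (Eventually.frequently ?_)
          filter_upwards [Ioo_mem_nhdsLT h] with r hr
          exact hlt r hr.1.le hr.2
    · intro s hs
      have : s = a := le_antisymm hs.2 hs.1
      exact this ▸ ha
    · intro t ht
      have hPt : P t := ht.1 t ⟨ht.2.1, le_rfl⟩
      obtain ⟨c, hc, hcs⟩ := mem_nhdsGT_iff_exists_Ioo_subset.1 (hr t ht.2.1 ht.2.2 hPt)
      refine mem_nhdsGT_iff_exists_Ioo_subset.2 ⟨c, hc, fun r hr s hs => ?_⟩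
      rcases lt_or_ge t s with h | h
      · exact hcs ⟨h, hs.2.trans_lt hr.2⟩
      · exact ht.1 s ⟨hs.1, h⟩
  intro t ht
  exact key ht t ⟨ht.1, le_rfl⟩

/-- No continuity is assumed, so this yields conservation laws for expressions in the velocity,
which jumps at collisions. -/
theorem eqOn_const_of_locally_const {α : Type*} {F : ℝ → α} {I : Set ℝ} (hI : I.OrdConnected)
    (hl : ∀ t ∈ I, ∀ᶠ s in 𝓝[<] t, F s = F t) (hr : ∀ t ∈ I, ∀ᶠ s in 𝓝[>] t, F s = F t)
    {a b : ℝ} (ha : a ∈ I) (hb : b ∈ I) : F a = F b := by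
  wlog hab : a ≤ b generalizing a b
  · exact (this hb ha (le_of_not_ge hab)).symm
  refine (forall_mem_Icc_of_local (P := fun t => F t = F a) rfl ?_ ?_ b ⟨hab, le_rfl⟩).symm
  · intro t h1 h2 h3
    filter_upwards [hr t (hI.out ha hb ⟨h1, h2.le⟩)] with s hs
    exact hs.trans h3
  · intro t h1 h2 h3
    obtain ⟨s, hs1, hs2⟩ := (h3.and_eventually (hl t (hI.out ha hb ⟨h1.le, h2⟩))).exists
    exact hs2.symm.trans hs1

variable {N : ℕ} {m p v w : Fin N → ℝ} {I : Set ℝ} {x : ℝ → Fin N → ℝ}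

/-! ### Collisions as reflections -/

/-- The normal vector of the wall `x i = x j` with respect to the kinetic form. -/
noncomputable def normal (m : Fin N → ℝ) (i j : Fin N) : Fin N → ℝ :=
  Pi.single i (m i)⁻¹ - Pi.single j (m j)⁻¹

theorem kineticForm_apply (m y z : Fin N → ℝ) : kineticForm m y z = ∑ i, y i * m i * z i := rfl

theorem kineticForm_comm (m y z : Fin N → ℝ) : kineticForm m y z = kineticForm m z y := by
  simp only [kineticForm_apply]
  exact Finset.sum_congr rfl fun i _ => by ring

theorem kineticForm_normal (hm : ∀ i, m i ≠ 0) (i j : Fin N) (y : Fin N → ℝ) :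
    kineticForm m (normal m i j) y = y i - y j := by
  simp [kineticForm_apply, normal, Pi.single_apply, hm]

theorem normal_mem_zeroMomentum (hm : ∀ i, m i ≠ 0) (i j : Fin N) :
    normal m i j ∈ zeroMomentum m := by
  change ∑ k, m k * normal m i j k = 0
  simp [normal, mul_sub, Finset.sum_sub_distrib, Pi.single_apply, hm]

theorem collisionCoeff_add (i j : Fin N) (h : m i + m j ≠ 0) :
    collisionCoeff m i j + collisionCoeff m j i = 2 := by
  have h' : m j + m i ≠ 0 := by rwa [add_comm]
  unfold collisionCoeff
  field_simp
  ring

theorem mul_collisionCoeff (m : Fin N → ℝ) (i j : Fin N) :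
    m i * collisionCoeff m i j = m j * collisionCoeff m j i := by
  unfold collisionCoeff
  rw [add_comm (m j)]
  ring

theorem collisionCoeff_neg (m : Fin N → ℝ) (i j : Fin N) :
    collisionCoeff (-m) i j = collisionCoeff m i j := by
  unfold collisionCoeff
  simp only [Pi.neg_apply]
  rw [← neg_add, mul_neg, neg_div_neg_eq]

namespace CollisionLaw

theorem neg_mass (h : CollisionLaw m p v w) : CollisionLaw (-m) p v w :=
  ⟨h.free, fun i j hij hp => by simpa only [collisionCoeff_neg] using h.meeting i j hij hp⟩

theorem congr_pos {q : Fin N → ℝ} (h : CollisionLaw m p v w)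
    (hpq : ∀ i j, p i = p j ↔ q i = q j) : CollisionLaw m q v w :=
  ⟨fun i hi => h.free i fun j hj hp => hi j hj ((hpq _ _).1 hp),
    fun i j hij hq => h.meeting i j hij ((hpq _ _).2 hq)⟩

/-- Particles in contact have equal entries in `p`, and the coefficients in the law sum to one, so
adding a multiple of `p` to the velocities is harmless. -/
theorem comb (h : CollisionLaw m p v w) (a b : ℝ) :
    CollisionLaw m p (a • p + b • v) (a • p + b • w) := by
  refine ⟨fun i hi => by simp [h.free i hi], fun i j hij hp => ?_⟩
  simp only [Pi.add_apply, Pi.smul_apply, smul_eq_mul, h.meeting i j hij hp, hp]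
  ring

theorem sub_eq (hpair : ∀ i j, i ≠ j → m i + m j ≠ 0) (h : CollisionLaw m p v w) {i j : Fin N}
    (hp : p i = p j) : w i - w j = v j - v i := by
  rcases eq_or_ne i j with rfl | hij
  · simp
  · rw [h.meeting i j hij hp, h.meeting j i hij.symm hp.symm]
    have := collisionCoeff_add i j (hpair i j hij)
    linear_combination (v j - v i) * this

theorem symm (hpair : ∀ i j, i ≠ j → m i + m j ≠ 0) (h : CollisionLaw m p v w) :
    CollisionLaw m p w v := by
  refine ⟨fun i hi => (h.free i hi).symm, fun i j hij hp => ?_⟩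
  have h1 := h.sub_eq hpair hp
  have h2 := h.meeting i j hij hp
  linear_combination (-1 : ℝ) * h2 + collisionCoeff m i j * h1

/-- If no three particles meet, the particles in contact are exchanged by an involution. -/
theorem exists_partner
    (hp : ∀ i j k : Fin N, i ≠ j → j ≠ k → i ≠ k → ¬ (p i = p j ∧ p j = p k))
    (h : CollisionLaw m p v w) : ∃ σ : Equiv.Perm (Fin N), (∀ i, σ (σ i) = i) ∧
      (∀ i, p (σ i) = p i) ∧ ∀ i, w i - v i = collisionCoeff m i (σ i) * (v (σ i) - v i) := by
  classical
  let f : Fin N → Fin N := fun i => if h : ∃ j, j ≠ i ∧ p j = p i then h.choose else i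
  have hf1 : ∀ i, p (f i) = p i := fun i => by
    by_cases h : ∃ j, j ≠ i ∧ p j = p i
    · simp only [f, dif_pos h]; exact h.choose_spec.2
    · simp only [f, dif_neg h]
  have hf2 : ∀ i j, j ≠ i → p j = p i → f i = j := fun i j hj hij => by
    have h : ∃ j, j ≠ i ∧ p j = p i := ⟨j, hj, hij⟩
    have h1 : f i ≠ i := by simp only [f, dif_pos h]; exact h.choose_spec.1
    by_contra hne
    exact hp j i (f i) hj h1.symm (Ne.symm hne) ⟨hij, (hf1 i).symm⟩
  have hff : ∀ i, f (f i) = i := fun i => by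
    rcases eq_or_ne (f i) i with h | h
    · rw [h, h]
    · exact hf2 _ _ h.symm (hf1 i).symm
  refine ⟨⟨f, f, hff, hff⟩, hff, hf1, fun i => ?_⟩
  change w i - v i = collisionCoeff m i (f i) * (v (f i) - v i)
  rcases eq_or_ne (f i) i with h' | h'
  · have : w i = v i := h.free i fun j hj hij => hj (by rw [← hf2 i j hj hij, h'])
    rw [this, h']; ring
  · rw [h.meeting i (f i) h'.symm (hf1 i).symm]; ring

theorem kineticForm_eq (hpair : ∀ i j, i ≠ j → m i + m j ≠ 0)
    (hp : ∀ i j k : Fin N, i ≠ j → j ≠ k → i ≠ k → ¬ (p i = p j ∧ p j = p k))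
    (h : CollisionLaw m p v w) : kineticForm m w w = kineticForm m v v := by
  obtain ⟨σ, hσ, hpσ, hw⟩ := h.exists_partner hp
  rw [← sub_eq_zero, kineticForm_apply, kineticForm_apply, ← Finset.sum_sub_distrib]
  have h1 := Equiv.sum_comp σ fun i => w i * m i * w i - v i * m i * v i
  -- Adding the sum to its reindexing by `σ` lets each particle cancel against its partner without
  -- choosing one representative of each pair.
  have h2 : (∑ i, (w i * m i * w i - v i * m i * v i)) +
      ∑ i, (w (σ i) * m (σ i) * w (σ i) - v (σ i) * m (σ i) * v (σ i)) = 0 := by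
    rw [← Finset.sum_add_distrib]
    refine Finset.sum_eq_zero fun i _ => ?_
    have e1 := hw i
    have e2 := hw (σ i)
    rw [hσ] at e2
    have e3 := h.sub_eq hpair (hpσ i)
    have e4 := mul_collisionCoeff m i (σ i)
    linear_combination m i * (w i + v i) * e1 + m (σ i) * (w (σ i) + v (σ i)) * e2 +
      (v (σ i) - v i) * (w i + v i) * e4 - m (σ i) * collisionCoeff m (σ i) i *
        (v (σ i) - v i) * e3
  linarith

theorem sub_mem (hm : ∀ i, m i ≠ 0)
    (hp : ∀ i j k : Fin N, i ≠ j → j ≠ k → i ≠ k → ¬ (p i = p j ∧ p j = p k))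
    (h : CollisionLaw m p v w) {W : Submodule ℝ (Fin N → ℝ)}
    (hW : ∀ i j, i ≠ j → p i = p j → v i ≠ v j → normal m i j ∈ W) : w - v ∈ W := by
  obtain ⟨σ, hσ, hpσ, hw⟩ := h.exists_partner hp
  have h1 : ∀ z : Fin N → ℝ, z = ∑ i, Pi.single i (z i) := fun z =>
    (Finset.univ_sum_single z).symm
  -- Each pair is counted twice, hence the factor 2. Conservation of momentum within a pair (`e5`)
  -- makes its velocity change a multiple of the normal.
  have h2 : (2 : ℝ) • (w - v) = ∑ i, (m i * (w i - v i)) • normal m i (σ i) := by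
    have h3 := Equiv.sum_comp σ fun i => (Pi.single i ((w - v) i) : Fin N → ℝ)
    have h4 : (2 : ℝ) • (w - v) = (∑ i, Pi.single i ((w - v) i)) +
        ∑ i, (Pi.single (σ i) ((w - v) (σ i)) : Fin N → ℝ) := by
      rw [h3, ← h1 (w - v), two_smul]
    rw [h4, ← Finset.sum_add_distrib]
    refine Finset.sum_congr rfl fun i _ => ?_
    have e1 := hw i
    have e2 := hw (σ i)
    rw [hσ] at e2
    have e4 := mul_collisionCoeff m i (σ i)
    have e5 : m (σ i) * (w (σ i) - v (σ i)) = -(m i * (w i - v i)) := by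
      rw [e1, e2]; linear_combination (v (σ i) - v i) * e4
    have e6 : m i * (w i - v i) * (m i)⁻¹ = w i - v i := by
      have := hm i; field_simp
    have e7 : m i * (w i - v i) * (m (σ i))⁻¹ = -(w (σ i) - v (σ i)) := by
      rw [← neg_eq_iff_eq_neg.2 e5]; have := hm (σ i); field_simp
    rw [normal, smul_sub, ← Pi.single_smul, ← Pi.single_smul, smul_eq_mul, smul_eq_mul, e6, e7,
      Pi.single_neg, sub_neg_eq_add]
    rfl
  have h3 : (2 : ℝ) • (w - v) ∈ W := by
    rw [h2]
    refine W.sum_mem fun i _ => ?_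
    by_cases hv : v (σ i) = v i
    · rw [hw i, hv]; simp
    · exact W.smul_mem _ (hW _ _ (fun e => hv (by rw [← e])) (hpσ i).symm (Ne.symm hv))
  simpa using W.smul_mem (2 : ℝ)⁻¹ h3

end CollisionLaw
/-! ### Velocities of a solution -/

theorem eventually_eventually_nhds_of_isOpen {U : Set ℝ} (hU : IsOpen U) {t : ℝ} {P : ℝ → Prop}
    (h : ∀ᶠ s in 𝓝[U] t, P s) : ∀ᶠ s in 𝓝[U] t, ∀ᶠ r in 𝓝 s, P r := by
  filter_upwards [eventually_eventually_nhdsWithin.2 h, self_mem_nhdsWithin] with s hs hsU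
  rwa [hU.nhdsWithin_eq hsU] at hs

/-- Near `t`, the motion `x` has velocity `v` before `t`, velocity `u t` after `t`, and `u` is the
right velocity. -/
structure VelocityAt (x u : ℝ → Fin N → ℝ) (t : ℝ) (v : Fin N → ℝ) : Prop where
  left : ∀ᶠ s in 𝓝[≤] t, x s = x t + (s - t) • v
  left_vel : ∀ᶠ s in 𝓝[<] t, u s = v
  right : ∀ᶠ s in 𝓝[≥] t, x s = x t + (s - t) • u t
  right_vel : ∀ᶠ s in 𝓝[>] t, u s = u t

theorem velocity_unique {f : Filter ℝ} [f.NeBot] {t : ℝ} {y a b : Fin N → ℝ}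
    (ht : ∀ᶠ s in f, s ≠ t) (ha : ∀ᶠ s in f, x s = y + (s - t) • a)
    (hb : ∀ᶠ s in f, x s = y + (s - t) • b) : a = b := by
  obtain ⟨s, h1, h2, h3⟩ := (ht.and (ha.and hb)).exists
  exact smul_right_injective _ (sub_ne_zero.2 h1) (add_left_cancel (h2.symm.trans h3))

namespace IsSolution

theorem mem_nhds (h : IsSolution m I x) {t : ℝ} (ht : t ∈ I) : ∀ᶠ s in 𝓝 t, s ∈ I :=
  h.isOpen.mem_nhds ht

/-- The right velocities chosen separately at each instant fit together, because on a one-sided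
neighbourhood the motion is affine and its slope is determined. -/
theorem exists_velocity (h : IsSolution m I x) : ∃ u : ℝ → Fin N → ℝ,
    ∀ t ∈ I, ∃ v, VelocityAt x u t v ∧ CollisionLaw m (x t) v (u t) := by
  have h' : ∀ t, ∃ v w : Fin N → ℝ, t ∈ I →
    (∀ᶠ s in 𝓝[≤] t, x s = x t + (s - t) • v) ∧
    (∀ᶠ s in 𝓝[≥] t, x s = x t + (s - t) • w) ∧ CollisionLaw m (x t) v w := fun t => by
    by_cases ht : t ∈ I
    · obtain ⟨v, w, hvw⟩ := h.motion t ht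
      exact ⟨v, w, fun _ => hvw⟩
    · exact ⟨0, 0, fun h => (ht h).elim⟩
  choose v u hu using h'
  have key : ∀ t a s b, s ∈ I → x s = x t + (s - t) • b →
      (∀ᶠ r in 𝓝 s, x r = x t + (r - t) • a) → u s = a := fun t a s b hs _ hr => by
    refine velocity_unique (f := 𝓝[>] s) (t := s) (y := x s) (x := x) ?_ ?_ ?_
    · filter_upwards [self_mem_nhdsWithin] with r hr using ne_of_gt hr
    · exact (hu s hs).2.1.filter_mono (nhdsWithin_mono _ Ioi_subset_Ici_self)
    · filter_upwards [hr.filter_mono nhdsWithin_le_nhds] with r hr'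
      rw [hr', hr.self_of_nhds]
      module
  refine ⟨u, fun t ht => ⟨v t, ⟨(hu t ht).1, ?_, (hu t ht).2.1, ?_⟩, (hu t ht).2.2⟩⟩
  · have h1 := (hu t ht).1.filter_mono (nhdsWithin_mono _ Iio_subset_Iic_self)
    filter_upwards [h1, eventually_eventually_nhds_of_isOpen isOpen_Iio h1,
      (h.mem_nhds ht).filter_mono nhdsWithin_le_nhds] with s h2 h3 h4
    exact key t _ s _ h4 h2 h3
  · have h1 := (hu t ht).2.1.filter_mono (nhdsWithin_mono _ Ioi_subset_Ici_self)
    filter_upwards [h1, eventually_eventually_nhds_of_isOpen isOpen_Ioi h1,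
      (h.mem_nhds ht).filter_mono nhdsWithin_le_nhds] with s h2 h3 h4
    exact key t _ s _ h4 h2 h3

theorem neg_mass (h : IsSolution m I x) : IsSolution (-m) I x :=
  ⟨h.isOpen, h.ordConnected, h.nonempty, h.no_multiple, fun t ht => by
    obtain ⟨v, w, h1, h2, h3⟩ := h.motion t ht
    exact ⟨v, w, h1, h2, h3.neg_mass⟩⟩

theorem mono (h : IsSolution m I x) {J : Set ℝ} (hJ : IsOpen J) (hJ' : J.OrdConnected)
    (hne : J.Nonempty) (hJI : J ⊆ I) : IsSolution m J x :=
  ⟨hJ, hJ', hne, fun t ht => h.no_multiple t (hJI ht), fun t ht => h.motion t (hJI ht)⟩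

/-- Time reversal. -/
theorem comp_neg (hpair : ∀ i j, i ≠ j → m i + m j ≠ 0) (h : IsSolution m I x) :
    IsSolution m (Neg.neg ⁻¹' I) fun t => x (-t) where
  isOpen := h.isOpen.preimage continuous_neg
  ordConnected := h.ordConnected.preimage_anti fun _ _ => neg_le_neg
  nonempty := by
    obtain ⟨t, ht⟩ := h.nonempty
    exact ⟨-t, by simpa⟩
  no_multiple := fun t ht => h.no_multiple (-t) ht
  motion := fun t ht => by
    obtain ⟨v, w, h1, h2, h3⟩ := h.motion (-t) ht
    refine ⟨(0 : ℝ) • x (-t) + (-1 : ℝ) • w, (0 : ℝ) • x (-t) + (-1 : ℝ) • v, ?_, ?_,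
      (h3.symm hpair).comb 0 (-1)⟩
    · have : Tendsto (fun s : ℝ => -s) (𝓝[≤] t) (𝓝[≥] (-t)) :=
        tendsto_nhdsWithin_iff.2 ⟨(continuous_neg.tendsto t).mono_left nhdsWithin_le_nhds, by
          filter_upwards [self_mem_nhdsWithin] with s (hs : s ≤ t) using neg_le_neg hs⟩
      filter_upwards [this.eventually h2] with s hs
      rw [hs]
      module
    · have : Tendsto (fun s : ℝ => -s) (𝓝[≥] t) (𝓝[≤] (-t)) :=
        tendsto_nhdsWithin_iff.2 ⟨(continuous_neg.tendsto t).mono_left nhdsWithin_le_nhds, by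
          filter_upwards [self_mem_nhdsWithin] with s (hs : t ≤ s) using neg_le_neg hs⟩
      filter_upwards [this.eventually h1] with s hs
      rw [hs]
      module

/-- The projective change of time `t ↦ 1 / t` turns solutions into solutions. -/
theorem comp_inv (hpair : ∀ i j, i ≠ j → m i + m j ≠ 0) (h : IsSolution m I x)
    (hI : (I ∩ Ioi 0).Nonempty) : IsSolution m (Inv.inv ⁻¹' I ∩ Ioi 0) fun t => t • x t⁻¹ where
  isOpen := by
    rw [inter_comm]
    exact (continuousOn_inv₀.mono fun t (ht : 0 < t) => ht.ne').isOpen_inter_preimage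
      isOpen_Ioi h.isOpen
  ordConnected := by
    refine ⟨fun a ha b hb t ht => ⟨?_, lt_of_lt_of_le ha.2 ht.1⟩⟩
    have ha' : 0 < a := ha.2
    have ht' : 0 < t := lt_of_lt_of_le ha.2 ht.1
    exact h.ordConnected.out hb.1 ha.1
      ⟨inv_anti₀ ht' ht.2, inv_anti₀ ha' ht.1⟩
  nonempty := by
    obtain ⟨t, ht, h0⟩ := hI
    exact ⟨t⁻¹, by simpa using ht, mem_Ioi.2 (inv_pos.2 h0)⟩
  no_multiple := fun t ht i j k hij hjk hik he => by
    have h0 : t ≠ 0 := ne_of_gt ht.2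
    refine h.no_multiple t⁻¹ ht.1 i j k hij hjk hik ⟨?_, ?_⟩
    · simpa [h0] using he.1
    · simpa [h0] using he.2
  motion := fun t ht => by
    have ht0 : 0 < t := ht.2
    have h0 : t ≠ 0 := ht0.ne'
    obtain ⟨v, w, h1, h2, h3⟩ := h.motion t⁻¹ ht.1
    have hpos : ∀ᶠ s in 𝓝 t, 0 < s := eventually_gt_nhds ht0
    have hlim : Tendsto (fun s : ℝ => s⁻¹) (𝓝 t) (𝓝 t⁻¹) := tendsto_inv₀ h0
    -- Straight flights stay straight, and the velocity `a` becomes `x t⁻¹ - t⁻¹ • a`. Inversion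
    -- reverses time, so incoming and outgoing velocities are exchanged below.
    have main : ∀ (s : ℝ) (a : Fin N → ℝ), 0 < s → x s⁻¹ = x t⁻¹ + (s⁻¹ - t⁻¹) • a →
        s • x s⁻¹ = t • x t⁻¹ + (s - t) • ((1 : ℝ) • x t⁻¹ + (-t⁻¹) • a) := fun s a hs e => by
      rw [e]
      ext i
      simp only [Pi.smul_apply, Pi.add_apply, smul_eq_mul]
      field_simp
      ring
    refine ⟨(1 : ℝ) • x t⁻¹ + (-t⁻¹) • w, (1 : ℝ) • x t⁻¹ + (-t⁻¹) • v, ?_, ?_,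
      ((h3.symm hpair).comb 1 (-t⁻¹)).congr_pos fun i j => by simp [h0]⟩
    · have : Tendsto (fun s : ℝ => s⁻¹) (𝓝[≤] t) (𝓝[≥] (t⁻¹)) :=
        tendsto_nhdsWithin_iff.2 ⟨hlim.mono_left nhdsWithin_le_nhds, by
          filter_upwards [self_mem_nhdsWithin, hpos.filter_mono nhdsWithin_le_nhds]
            with s hs hs0 using inv_anti₀ hs0 hs⟩
      filter_upwards [this.eventually h2, hpos.filter_mono nhdsWithin_le_nhds] with s hs hs0
      exact main s w hs0 hs
    · have : Tendsto (fun s : ℝ => s⁻¹) (𝓝[≥] t) (𝓝[≤] (t⁻¹)) :=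
        tendsto_nhdsWithin_iff.2 ⟨hlim.mono_left nhdsWithin_le_nhds, by
          filter_upwards [self_mem_nhdsWithin] with s hs using inv_anti₀ ht0 hs⟩
      filter_upwards [this.eventually h1, hpos.filter_mono nhdsWithin_le_nhds] with s hs hs0
      exact main s v hs0 hs

end IsSolution

/-! ### Times of collisions -/

/-- The times at which some collision happens. -/
def collisionTimes (I : Set ℝ) (x : ℝ → Fin N → ℝ) : Set ℝ :=
  {t | t ∈ I ∧ ∃ i j, x t i = x t j ∧ ∀ᶠ s in 𝓝[<] t, x s i ≠ x s j}

theorem finite_collisions_iff : (collisions I x).Finite ↔ (collisionTimes I x).Finite := by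
  constructor
  · refine fun h => (h.image Prod.fst).subset ?_
    rintro t ⟨ht, i, j, hij, hs⟩
    have hne : i ≠ j := by
      rintro rfl
      obtain ⟨s, hs⟩ := hs.exists
      exact hs rfl
    rcases lt_or_gt_of_ne hne with hlt | hlt
    · exact ⟨(t, i, j), ⟨ht, hlt, hij, hs⟩, rfl⟩
    · exact ⟨(t, j, i), ⟨ht, hlt, hij.symm, hs.mono fun s hs => hs.symm⟩, rfl⟩
  · refine fun h => (h.prod (Set.finite_univ (α := Fin N × Fin N))).subset ?_
    rintro ⟨t, i, j⟩ ⟨ht, hij, he, hs⟩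
    exact ⟨⟨ht, i, j, he, hs⟩, mem_univ _⟩

theorem eventually_ne_iff_left {t : ℝ} {v : Fin N → ℝ} {i j : Fin N} (hij : x t i = x t j)
    (h : ∀ᶠ s in 𝓝[≤] t, x s = x t + (s - t) • v) :
    (∀ᶠ s in 𝓝[<] t, x s i ≠ x s j) ↔ v i ≠ v j := by
  have h' := h.filter_mono (nhdsWithin_mono t Iio_subset_Iic_self)
  constructor
  · intro h1 h2
    obtain ⟨s, h3, h4⟩ := (h1.and h').exists
    exact h3 (by simp [h4, hij, h2])
  · intro h1
    filter_upwards [h', self_mem_nhdsWithin] with s hs hst he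
    simp only [hs, Pi.add_apply, Pi.smul_apply, hij, smul_eq_mul] at he
    exact h1 (mul_left_cancel₀ (sub_ne_zero.2 (ne_of_lt hst)) (add_left_cancel he))

theorem eventually_ne_iff_right {t : ℝ} {v : Fin N → ℝ} {i j : Fin N} (hij : x t i = x t j)
    (h : ∀ᶠ s in 𝓝[≥] t, x s = x t + (s - t) • v) :
    (∀ᶠ s in 𝓝[>] t, x s i ≠ x s j) ↔ v i ≠ v j := by
  have h' := h.filter_mono (nhdsWithin_mono t Ioi_subset_Ici_self)
  constructor
  · intro h1 h2
    obtain ⟨s, h3, h4⟩ := (h1.and h').exists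
    exact h3 (by simp [h4, hij, h2])
  · intro h1
    filter_upwards [h', self_mem_nhdsWithin] with s hs hst he
    simp only [hs, Pi.add_apply, Pi.smul_apply, hij, smul_eq_mul] at he
    exact h1 (mul_left_cancel₀ (sub_ne_zero.2 (ne_of_gt hst)) (add_left_cancel he))

/-- The relative velocity only changes sign at a contact. This makes the notion of collision,
defined through the past, invariant under reversal of time. -/
theorem IsSolution.eventually_ne_left_iff_right (hpair : ∀ i j, i ≠ j → m i + m j ≠ 0)
    (h : IsSolution m I x) {t : ℝ} (ht : t ∈ I) {i j : Fin N} (hij : x t i = x t j) :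
    (∀ᶠ s in 𝓝[<] t, x s i ≠ x s j) ↔ ∀ᶠ s in 𝓝[>] t, x s i ≠ x s j := by
  obtain ⟨v, w, h1, h2, h3⟩ := h.motion t ht
  rw [eventually_ne_iff_left hij h1, eventually_ne_iff_right hij h2, ← sub_ne_zero (a := w i),
    h3.sub_eq hpair hij, sub_ne_zero]
  exact ne_comm

theorem IsSolution.neg_mem_collisionTimes (hpair : ∀ i j, i ≠ j → m i + m j ≠ 0)
    (h : IsSolution m I x) {t : ℝ} (ht : t ∈ collisionTimes I x) :
    -t ∈ collisionTimes (Neg.neg ⁻¹' I) fun t => x (-t) := by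
  obtain ⟨htI, i, j, hij, hs⟩ := ht
  refine ⟨by simpa, i, j, by simpa, ?_⟩
  have : Tendsto (fun s : ℝ => -s) (𝓝[<] (-t)) (𝓝[>] t) :=
    tendsto_nhdsWithin_iff.2 ⟨by
      simpa using (continuous_neg.tendsto (-t)).mono_left nhdsWithin_le_nhds, by
      filter_upwards [self_mem_nhdsWithin] with s (hs : s < -t) using lt_neg_of_lt_neg hs⟩
  exact this.eventually ((h.eventually_ne_left_iff_right hpair htI hij).1 hs)

theorem IsSolution.inv_mem_collisionTimes (hpair : ∀ i j, i ≠ j → m i + m j ≠ 0)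
    (h : IsSolution m I x) {t : ℝ} (ht : t ∈ collisionTimes I x) (h0 : 0 < t) :
    t⁻¹ ∈ collisionTimes (Inv.inv ⁻¹' I ∩ Ioi 0) fun t => t • x t⁻¹ := by
  obtain ⟨htI, i, j, hij, hs⟩ := ht
  refine ⟨⟨by simpa, inv_pos.2 h0⟩, i, j, by simp [hij], ?_⟩
  have hpos : ∀ᶠ s in 𝓝[<] t⁻¹, 0 < s :=
    (eventually_gt_nhds (inv_pos.2 h0)).filter_mono nhdsWithin_le_nhds
  have : Tendsto (fun s : ℝ => s⁻¹) (𝓝[<] t⁻¹) (𝓝[>] t) :=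
    tendsto_nhdsWithin_iff.2 ⟨by
      simpa using (tendsto_inv₀ (inv_pos.2 h0).ne').mono_left nhdsWithin_le_nhds, by
      filter_upwards [self_mem_nhdsWithin, hpos] with s hs hs0 using (lt_inv_comm₀ hs0 h0).1 hs⟩
  filter_upwards [this.eventually ((h.eventually_ne_left_iff_right hpair htI hij).1 hs), hpos]
    with s hs hs0
  simpa [hs0.ne'] using hs

/-! ### Definite kinetic form: collisions do not accumulate -/

theorem exists_projection {W : Submodule ℝ (Fin N → ℝ)}
    (hW : ∀ y ∈ W, y ≠ 0 → 0 < kineticForm m y y) :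
    ∃ π : (Fin N → ℝ) →ₗ[ℝ] (Fin N → ℝ), (∀ z, π z ∈ W) ∧ (∀ z ∈ W, π z = z) ∧
      ∀ z, ∀ y ∈ W, kineticForm m y (π z) = kineticForm m y z := by
  have hrefl : (kineticForm m).IsRefl := fun a b h => by rw [kineticForm_comm, h]
  have hnd : ((kineticForm m).restrict W).Nondegenerate := by
    constructor
    · rintro ⟨y, hy⟩ h
      by_contra hne
      exact (hW y hy fun e => hne (Subtype.ext e)).ne' (h ⟨y, hy⟩)
    · rintro ⟨y, hy⟩ h
      by_contra hne
      exact (hW y hy fun e => hne (Subtype.ext e)).ne' (h ⟨y, hy⟩)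
  have hc := LinearMap.BilinForm.isCompl_orthogonal_of_restrict_nondegenerate hrefl hnd
  refine ⟨W.projection _ hc, Submodule.projection_apply_mem hc,
    fun z hz => Submodule.projection_apply_of_mem_left hc hz, fun z y hy => ?_⟩
  have h1 : kineticForm m y (z - W.projection _ hc z) = 0 :=
    Submodule.sub_projection_mem hc z y hy
  rw [map_sub, sub_eq_zero] at h1
  exact h1.symm

theorem kineticForm_sq_le {W : Submodule ℝ (Fin N → ℝ)}
    (hW : ∀ y ∈ W, 0 ≤ kineticForm m y y) {y z : Fin N → ℝ} (hy : y ∈ W) (hz : z ∈ W) :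
    kineticForm m y z ^ 2 ≤ kineticForm m y y * kineticForm m z z :=
  LinearMap.BilinForm.apply_sq_le_of_symm ((kineticForm m).restrict W) (fun w => hW w w.2)
    ⟨fun a b => kineticForm_comm m a b⟩ ⟨y, hy⟩ ⟨z, hz⟩

theorem IsSolution.continuousAt (h : IsSolution m I x) {t : ℝ} (ht : t ∈ I) :
    ContinuousAt x t := by
  obtain ⟨v, w, h1, h2, -⟩ := h.motion t ht
  have aux : ∀ a : Fin N → ℝ, Tendsto (fun s : ℝ => x t + (s - t) • a) (𝓝 t) (𝓝 (x t)) :=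
    fun a => by
      have : Continuous fun s : ℝ => x t + (s - t) • a := by fun_prop
      simpa using this.tendsto t
  refine continuousAt_iff_continuous_left_right.2 ⟨?_, ?_⟩
  · exact ((aux v).mono_left nhdsWithin_le_nhds).congr' (h1.mono fun s hs => hs.symm)
  · exact ((aux w).mono_left nhdsWithin_le_nhds).congr' (h2.mono fun s hs => hs.symm)

theorem VelocityAt.hasDerivWithinAt {u : ℝ → Fin N → ℝ} {t : ℝ} (h : VelocityAt x u t v) :
    HasDerivWithinAt x (u t) (Ici t) t := by
  have h1 : HasDerivWithinAt (fun s : ℝ => x t + (s - t) • u t) ((1 : ℝ) • u t) (Ici t) t :=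
    ((((hasDerivAt_id t).sub_const t).smul_const (u t)).const_add (x t)).hasDerivWithinAt
  rw [one_smul] at h1
  exact h1.congr_of_eventuallyEq h.right (by simp)

/-- The motion projected to the span of the recurring normals would have to be a straight flight
into the apex at time `T`, and such a flight hits none of these walls before `T`. -/
theorem IsSolution.not_frequently_mem_collisionTimes (hm : ∀ i, m i ≠ 0)
    (hpair : ∀ i j, i ≠ j → m i + m j ≠ 0)
    (hpos : ∀ y ∈ zeroMomentum m, y ≠ 0 → 0 < kineticForm m y y)
    (h : IsSolution m I x) {c T : ℝ} (hcT : c < T) (hI : Ioo c T ⊆ I) :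
    ¬ ∃ᶠ t in 𝓝[<] T, t ∈ collisionTimes I x := by
  intro hfreq
  obtain ⟨u, hu⟩ := h.exists_velocity
  let coll : ℝ → Fin N → Fin N → Prop := fun t i j =>
    x t i = x t j ∧ ∀ᶠ s in 𝓝[<] t, x s i ≠ x s j
  -- The pairs that collide arbitrarily close to `T`. There are finitely many pairs, so close enough
  -- to `T` no others collide.
  let A : Set (Fin N × Fin N) := {q | ∃ᶠ t in 𝓝[<] T, coll t q.1 q.2}
  have hA : ∀ᶠ t in 𝓝[<] T, ∀ q : Fin N × Fin N, coll t q.1 q.2 → q ∈ A :=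
    eventually_all.2 fun q => by
      by_cases hq : q ∈ A
      · exact Eventually.of_forall fun t _ => hq
      · filter_upwards [not_frequently.1 hq] with t ht h' using (ht h').elim
  obtain ⟨c', hc'T, hc'⟩ := mem_nhdsLT_iff_exists_Ioo_subset.1
    (inter_mem (Ioo_mem_nhdsLT hcT) hA)
  set J := Ioo c' T with hJ
  have hJI : J ⊆ I := fun t ht => hI (hc' ht).1
  have hJA : ∀ t ∈ J, ∀ i j, coll t i j → (i, j) ∈ A := fun t ht i j => (hc' ht).2 (i, j)
  have hJT : ∀ᶠ t in 𝓝[<] T, t ∈ J := Ioo_mem_nhdsLT hc'T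
  let W : Submodule ℝ (Fin N → ℝ) := Submodule.span ℝ ((fun q => normal m q.1 q.2) '' A)
  have hnW : ∀ i j, (i, j) ∈ A → normal m i j ∈ W := fun i j hij =>
    Submodule.subset_span ⟨(i, j), hij, rfl⟩
  have hWP : W ≤ zeroMomentum m := Submodule.span_le.2 <| by
    rintro _ ⟨q, -, rfl⟩
    exact normal_mem_zeroMomentum hm _ _
  have hWpos : ∀ y ∈ W, y ≠ 0 → 0 < kineticForm m y y := fun y hy => hpos y (hWP hy)
  have hWnn : ∀ y ∈ W, 0 ≤ kineticForm m y y := fun y hy => by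
    rcases eq_or_ne y 0 with rfl | hne
    · simp
    · exact (hWpos y hy hne).le
  obtain ⟨π, hπW, hπid, hπ⟩ := exists_projection hWpos
  let Q : (Fin N → ℝ) → ℝ := fun z => kineticForm m (π z) (π z)
  have hQnn : ∀ z, 0 ≤ Q z := fun z => hWnn _ (hπW z)
  -- For a displacement in `W`, the change of the full form equals the change of `Q`, as both
  -- involve only pairings with `W`.
  have hQsub : ∀ z z', z' - z ∈ W → kineticForm m z' z' = kineticForm m z z → Q z' = Q z := by
    intro z z' hd he
    obtain ⟨d, rfl⟩ : ∃ d, z' = z + d := ⟨z' - z, by abel⟩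
    rw [add_sub_cancel_left] at hd
    have h1 : kineticForm m d (π z) = kineticForm m d z := hπ z d hd
    have h2 := kineticForm_comm m z d
    have h3 := kineticForm_comm m (π z) d
    simp only [Q, map_add, LinearMap.add_apply, hπid d hd] at he ⊢
    linarith
  have hcoll : ∀ t ∈ J, ∀ v, VelocityAt x u t v → CollisionLaw m (x t) v (u t) →
      ∀ a b : ℝ, Q (a • x t + b • u t) = Q (a • x t + b • v) := by
    intro t ht v hv hl a b
    have hl' := hl.comb a b
    refine hQsub _ _ ?_ (hl'.kineticForm_eq hpair (h.no_multiple t (hJI ht)))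
    have : u t - v ∈ W := hl.sub_mem hm (h.no_multiple t (hJI ht)) fun i j _ hij hne =>
      hnW i j (hJA t ht i j ⟨hij, (eventually_ne_iff_left hij hv.left).2 hne⟩)
    have h2 : a • x t + b • u t - (a • x t + b • v) = b • (u t - v) := by module
    rw [h2]
    exact W.smul_mem _ this
  have hE : ∀ s ∈ J, ∀ t ∈ J, Q (u s) = Q (u t) := by
    intro s hs t ht
    refine eqOn_const_of_locally_const (F := fun t => Q (u t)) ordConnected_Ioo ?_ ?_ hs ht
    · intro t ht
      obtain ⟨v, hv, hl⟩ := hu t (hJI ht)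
      filter_upwards [hv.left_vel] with s hs
      have := hcoll t ht v hv hl 0 1
      simp only [zero_smul, one_smul, zero_add] at this
      rw [hs, this]
    · intro t ht
      obtain ⟨v, hv, hl⟩ := hu t (hJI ht)
      filter_upwards [hv.right_vel] with s hs
      rw [hs]
  -- The vector `x t - (t - T) • u t` is the position at time `T` extrapolated from time `t`. It is
  -- constant during free flight.
  have hG : ∀ s ∈ J, ∀ t ∈ J, Q (x s - (s - T) • u s) = Q (x t - (t - T) • u t) := by
    intro s hs t ht
    refine eqOn_const_of_locally_const (F := fun t => Q (x t - (t - T) • u t))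
      ordConnected_Ioo ?_ ?_ hs ht
    · intro t ht
      obtain ⟨v, hv, hl⟩ := hu t (hJI ht)
      filter_upwards [hv.left_vel, hv.left.filter_mono (nhdsWithin_mono t Iio_subset_Iic_self)]
        with s hs hs'
      have := hcoll t ht v hv hl 1 (T - t)
      rw [show x t - (t - T) • u t = (1 : ℝ) • x t + (T - t) • u t by module, this, hs, hs']
      congr 1
      module
    · intro t ht
      obtain ⟨v, hv, hl⟩ := hu t (hJI ht)
      filter_upwards [hv.right_vel, hv.right.filter_mono (nhdsWithin_mono t Ioi_subset_Ici_self)]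
        with s hs hs'
      rw [hs, hs']
      congr 1
      module
  obtain ⟨t₀, ht₀⟩ := hJT.exists
  have hbound : ∀ i j, (i, j) ∈ A → ∃ C, ∀ t ∈ J, |u t i - u t j| ≤ C := by
    intro i j hij
    refine ⟨√(kineticForm m (normal m i j) (normal m i j) * Q (u t₀)), fun t ht => ?_⟩
    refine Real.le_sqrt_of_sq_le ?_
    have h1 := kineticForm_sq_le hWnn (hnW i j hij) (hπW (u t))
    rw [hπ _ _ (hnW i j hij), kineticForm_normal hm] at h1
    rw [sq_abs, hE t₀ ht₀ t ht]
    exact h1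
  have hlim : ∀ i j, (i, j) ∈ A → Tendsto (fun t => x t i - x t j) (𝓝[<] T) (𝓝 0) := by
    intro i j hij
    obtain ⟨C, hC⟩ := hbound i j hij
    have hC0 : 0 ≤ C := (abs_nonneg _).trans (hC t₀ ht₀)
    -- The pair meets again at some `t₁` between `t` and `T`, and its relative speed is at most `C`
    -- until then.
    have hle : ∀ t ∈ J, |x t i - x t j| ≤ C * (T - t) := by
      intro t ht
      obtain ⟨t₁, h1, h2⟩ := (((show ∃ᶠ t in 𝓝[<] T, coll t i j from hij).and_eventually
        (Ioo_mem_nhdsLT ht.2))).exists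
      have hsub : Icc t t₁ ⊆ J := fun s hs => ⟨ht.1.trans_le hs.1, hs.2.trans_lt h2.2⟩
      have h3 := norm_image_sub_le_of_norm_deriv_right_le_segment (a := t) (b := t₁)
        (f := fun s => x s i - x s j) (f' := fun s => u s i - u s j) (C := C) ?_ ?_ ?_ t₁
        ⟨h2.1.le, le_rfl⟩
      · rw [Real.norm_eq_abs, h1.1, sub_self, zero_sub, abs_neg] at h3
        exact h3.trans (mul_le_mul_of_nonneg_left (by linarith [h2.2]) hC0)
      · intro s hs
        have := h.continuousAt (hJI (hsub hs))
        exact ((continuousAt_pi.1 this i).sub (continuousAt_pi.1 this j)).continuousWithinAt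
      · intro s hs
        obtain ⟨v, hv, -⟩ := hu s (hJI (hsub (Ico_subset_Icc_self hs)))
        have := hasDerivWithinAt_pi.1 hv.hasDerivWithinAt
        exact (this i).sub (this j)
      · intro s hs
        exact hC s (hsub (Ico_subset_Icc_self hs))
    have h0 : Tendsto (fun t : ℝ => C * (T - t)) (𝓝[<] T) (𝓝 0) := by
      have : Continuous fun t : ℝ => C * (T - t) := by fun_prop
      simpa using (this.tendsto T).mono_left nhdsWithin_le_nhds
    refine squeeze_zero_norm' ?_ h0
    filter_upwards [hJT] with t ht using hle t ht
  -- The differences of coordinates over `A` are the pairings with the spanning normals. They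
  -- determine an element of `W` because the form is definite there, so convergence of the
  -- differences gives convergence of `π (x t)`.
  let Φ : (Fin N → ℝ) →ₗ[ℝ] (A → ℝ) :=
    LinearMap.pi fun q : A =>
      LinearMap.proj (R := ℝ) (φ := fun _ : Fin N => ℝ) q.1.1 - LinearMap.proj q.1.2
  have hΦ : LinearMap.ker (Φ ∘ₗ W.subtype) = ⊥ := by
    rw [LinearMap.ker_eq_bot']
    rintro ⟨y, hy⟩ h0
    by_contra hne
    refine (hWpos y hy fun e => hne (Subtype.ext e)).ne' ?_
    have : W ≤ LinearMap.ker ((kineticForm m).flip y) := Submodule.span_le.2 <| by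
      rintro _ ⟨q, hq, rfl⟩
      have := congrFun h0 ⟨q, hq⟩
      change kineticForm m (normal m q.1 q.2) y = 0
      rw [kineticForm_normal hm]
      exact this
    exact this hy
  obtain ⟨L, hL⟩ := LinearMap.exists_leftInverse_of_injective _ hΦ
  have hπlim : Tendsto (fun t => π (x t)) (𝓝[<] T) (𝓝 0) := by
    have h1 : Tendsto (fun t => Φ (π (x t))) (𝓝[<] T) (𝓝 0) := by
      refine tendsto_pi_nhds.2 fun q => ?_
      refine (hlim q.1.1 q.1.2 q.2).congr fun t => ?_
      have := hπ (x t) _ (hnW q.1.1 q.1.2 q.2)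
      rw [kineticForm_normal hm, kineticForm_normal hm] at this
      exact this.symm
    have h2 : Continuous (W.subtype ∘ₗ L) := LinearMap.continuous_of_finiteDimensional _
    have h3 := (h2.tendsto 0).comp h1
    rw [map_zero] at h3
    refine h3.congr fun t => ?_
    have := LinearMap.congr_fun hL ⟨π (x t), hπW _⟩
    exact congrArg Subtype.val this
  have hQlim : Tendsto (fun t => Q (x t)) (𝓝[<] T) (𝓝 0) := by
    have h2 : Continuous fun y : Fin N → ℝ => kineticForm m y y := by
      simp only [kineticForm_apply]
      fun_prop
    have h3 := (h2.tendsto 0).comp hπlim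
    rw [map_zero] at h3
    exact h3
  have hG0 : Q (x t₀ - (t₀ - T) • u t₀) = 0 := by
    refine le_antisymm ?_ (hQnn _)
    -- This bounds `Q (x t - (t - T) • u t)` by the parallelogram identity.
    have hlim2 : Tendsto (fun t => 2 * Q (x t) + 2 * (t - T) ^ 2 * Q (u t₀)) (𝓝[<] T) (𝓝 0) := by
      have : Continuous fun t : ℝ => 2 * (t - T) ^ 2 * Q (u t₀) := by fun_prop
      have := (hQlim.const_mul 2).add ((this.tendsto T).mono_left nhdsWithin_le_nhds)
      simpa using this
    refine ge_of_tendsto hlim2 ?_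
    filter_upwards [hJT] with t ht
    rw [hG t₀ ht₀ t ht, hE t₀ ht₀ t ht]
    have h1 := hQnn (x t + (t - T) • u t)
    have h2 := kineticForm_comm m (π (x t)) (π (u t))
    simp only [Q, map_add, map_sub, map_smul, LinearMap.add_apply, LinearMap.sub_apply,
      LinearMap.smul_apply, smul_eq_mul] at h1 ⊢
    nlinarith
  obtain ⟨t, ⟨htI, i, j, hij, hne⟩, ht⟩ := (hfreq.and_eventually hJT).exists
  have hA' : (i, j) ∈ A := hJA t ht i j ⟨hij, hne⟩
  obtain ⟨v, hv, hl⟩ := hu t htI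
  have hv' : v i ≠ v j := (eventually_ne_iff_left hij hv.left).1 hne
  have h0 : π (x t - (t - T) • u t) = 0 := by
    by_contra hne0
    have := hWpos _ (hπW _) hne0
    exact this.ne' ((hG t ht t₀ ht₀).trans hG0)
  have h1 := hπ (x t - (t - T) • u t) _ (hnW i j hA')
  rw [h0, map_zero, kineticForm_normal hm] at h1
  simp only [Pi.sub_apply, Pi.smul_apply, smul_eq_mul, hij] at h1
  have h2 : (t - T) * (u t i - u t j) = 0 := by linarith
  rcases mul_eq_zero.1 h2 with h3 | h3
  · exact absurd ht.2 (by linarith)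
  · rw [hl.sub_eq hpair hij] at h3
    exact hv' (by linarith)

theorem IsSolution.not_frequently_mem_collisionTimes_right (hm : ∀ i, m i ≠ 0)
    (hpair : ∀ i j, i ≠ j → m i + m j ≠ 0)
    (hpos : ∀ y ∈ zeroMomentum m, y ≠ 0 → 0 < kineticForm m y y)
    (h : IsSolution m I x) {c T : ℝ} (hcT : T < c) (hI : Ioo T c ⊆ I) :
    ¬ ∃ᶠ t in 𝓝[>] T, t ∈ collisionTimes I x := by
  intro hf
  refine (h.comp_neg hpair).not_frequently_mem_collisionTimes hm hpair hpos (neg_lt_neg hcT)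
    (fun t ht => hI ⟨lt_neg_of_lt_neg ht.2, neg_lt.1 ht.1⟩) ?_
  have : Tendsto (fun s : ℝ => -s) (𝓝[>] T) (𝓝[<] (-T)) :=
    tendsto_nhdsWithin_iff.2 ⟨(continuous_neg.tendsto T).mono_left nhdsWithin_le_nhds, by
      filter_upwards [self_mem_nhdsWithin] with s (hs : T < s) using neg_lt_neg hs⟩
  exact this.frequently (hf.mono fun t ht => h.neg_mem_collisionTimes hpair ht)

/-- The time change $t\mapsto 1/t$ brings infinity to the right side of $0$. -/
theorem IsSolution.not_frequently_atTop_mem_collisionTimes (hm : ∀ i, m i ≠ 0)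
    (hpair : ∀ i j, i ≠ j → m i + m j ≠ 0)
    (hpos : ∀ y ∈ zeroMomentum m, y ≠ 0 → 0 < kineticForm m y y)
    (h : IsSolution m I x) {c : ℝ} (hI : Ioi c ⊆ I) :
    ¬ ∃ᶠ t in atTop, t ∈ collisionTimes I x := by
  intro hf
  set d := max c 1 with hd
  have hd0 : 0 < d := lt_max_of_lt_right one_pos
  have hdI : ∀ t, d < t → t ∈ I := fun t ht => hI ((le_max_left _ _).trans_lt ht)
  refine (h.comp_inv hpair ⟨d + 1, hdI _ (lt_add_one d), mem_Ioi.2 (by linarith)⟩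
    ).not_frequently_mem_collisionTimes_right hm hpair hpos (inv_pos.2 hd0)
    (fun t ht => ⟨hdI _ ((lt_inv_comm₀ ht.1 hd0).1 ht.2), ht.1⟩) ?_
  refine tendsto_inv_atTop_nhdsGT_zero.frequently
    ((hf.and_eventually (eventually_gt_atTop 0)).mono fun t ht => ?_)
  exact h.inv_mem_collisionTimes hpair ht.1 ht.2

theorem IsSolution.finite_collisionTimes (hm : ∀ i, m i ≠ 0)
    (hpair : ∀ i j, i ≠ j → m i + m j ≠ 0)
    (hpos : ∀ y ∈ zeroMomentum m, y ≠ 0 → 0 < kineticForm m y y)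
    (h : IsSolution m I x) : (collisionTimes I x).Finite := by
  by_contra hinf
  have hSI : collisionTimes I x ⊆ I := fun t ht => ht.1
  have htop : ∀ {J : Set ℝ} {y : ℝ → Fin N → ℝ}, IsSolution m J y →
      BddAbove (collisionTimes J y) := by
    intro J y hy
    by_contra hb
    have hb' : ∀ a, ∃ t ∈ collisionTimes J y, a < t := by simpa [not_bddAbove_iff] using hb
    obtain ⟨c, hc, -⟩ := hb' 0
    refine hy.not_frequently_atTop_mem_collisionTimes hm hpair hpos (c := c) (fun t ht => ?_)
      (frequently_atTop.2 fun a => ?_)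
    · obtain ⟨s, hs, hts⟩ := hb' t
      exact hy.ordConnected.out hc.1 hs.1 ⟨le_of_lt ht, hts.le⟩
    · obtain ⟨s, hs, hts⟩ := hb' a
      exact ⟨s, hts.le, hs⟩
  obtain ⟨b, hb⟩ := htop h
  obtain ⟨a, ha⟩ := htop (h.comp_neg hpair)
  obtain ⟨q, -, hq⟩ := Set.Infinite.exists_accPt_of_subset_isCompact hinf
    (isCompact_Icc (a := -a) (b := b))
    (fun t ht => ⟨neg_le.1 (ha (h.neg_mem_collisionTimes hpair ht)), hb ht⟩)
  have hq' : ∃ᶠ t in 𝓝[≠] q, t ∈ collisionTimes I x := accPt_iff_frequently_nhdsNE.1 hq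
  rw [← nhdsLT_sup_nhdsGT, frequently_sup] at hq'
  rcases hq' with hf | hf
  · obtain ⟨c, hc, hcq⟩ := (hf.and_eventually self_mem_nhdsWithin).exists
    refine h.not_frequently_mem_collisionTimes hm hpair hpos hcq (fun t ht => ?_) hf
    obtain ⟨s, hs, hsq⟩ := (hf.and_eventually (Ioo_mem_nhdsLT ht.2)).exists
    exact h.ordConnected.out hc.1 hs.1 ⟨ht.1.le, hsq.1.le⟩
  · obtain ⟨c, hc, hcq⟩ := (hf.and_eventually self_mem_nhdsWithin).exists
    refine h.not_frequently_mem_collisionTimes_right hm hpair hpos hcq (fun t ht => ?_) hf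
    obtain ⟨s, hs, hsq⟩ := (hf.and_eventually (Ioo_mem_nhdsGT ht.1)).exists
    exact h.ordConnected.out hs.1 hc.1 ⟨hsq.2.le, ht.2.le⟩

/-! ### Consequences of definiteness -/

theorem kineticForm_neg (m y z : Fin N → ℝ) : kineticForm (-m) y z = -kineticForm m y z := by
  simp [kineticForm_apply]

theorem mem_zeroMomentum {y : Fin N → ℝ} : y ∈ zeroMomentum m ↔ ∑ i, m i * y i = 0 := Iff.rfl

theorem mem_zeroMomentum_neg {y : Fin N → ℝ} : y ∈ zeroMomentum (-m) ↔ y ∈ zeroMomentum m := by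
  simp [mem_zeroMomentum]

theorem isDefinite_iff :
    IsDefinite ((kineticForm m).restrict (zeroMomentum m)) ↔
      (∀ y ∈ zeroMomentum m, y ≠ 0 → 0 < kineticForm m y y) ∨
        ∀ y ∈ zeroMomentum m, y ≠ 0 → kineticForm m y y < 0 := by
  simp [IsDefinite, Subtype.forall]

theorem finite_collisions_of_isDefinite (hm : ∀ i, m i ≠ 0)
    (hpair : ∀ i j, i ≠ j → m i + m j ≠ 0)
    (hdef : IsDefinite ((kineticForm m).restrict (zeroMomentum m)))
    (h : IsSolution m I x) : (collisions I x).Finite := by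
  rw [finite_collisions_iff]
  rcases isDefinite_iff.1 hdef with hpos | hneg
  · exact h.finite_collisionTimes hm hpair hpos
  · refine h.neg_mass.finite_collisionTimes (m := -m) (fun i => neg_ne_zero.2 (hm i))
      (fun i j hij => ?_) fun y hy hne => ?_
    · rw [Pi.neg_apply, Pi.neg_apply, ← neg_add]
      exact neg_ne_zero.2 (hpair i j hij)
    · rw [kineticForm_neg]
      exact neg_pos.2 (hneg y (mem_zeroMomentum_neg.1 hy) hne)

/-- If $M=0$, the vector $(1,\dots,1)$ is a nonzero isotropic vector of $P_0$. -/
theorem totalMass_ne_zero_of_isDefinite (hN : 0 < N)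
    (hdef : IsDefinite ((kineticForm m).restrict (zeroMomentum m))) : totalMass m ≠ 0 := by
  intro h0
  have h1 : (1 : Fin N → ℝ) ∈ zeroMomentum m := by simpa [mem_zeroMomentum, totalMass] using h0
  have h2 : (1 : Fin N → ℝ) ≠ 0 := fun e => one_ne_zero (congrFun e ⟨0, hN⟩)
  have h3 : kineticForm m 1 1 = 0 := by simpa [kineticForm_apply, totalMass] using h0
  rcases isDefinite_iff.1 hdef with h | h
  · exact (h _ h1 h2).ne' h3
  · exact (h _ h1 h2).ne h3

/-! ### Extending solutions -/

theorem IsSolution.exists_maximal (h : IsSolution m I x) : ∃ (J : Set ℝ) (y : ℝ → Fin N → ℝ),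
    IsMaximalSolution m J y ∧ I ⊆ J ∧ EqOn y x I := by
  let S := {q : Set ℝ × (ℝ → Fin N → ℝ) // IsSolution m q.1 q.2 ∧ I ⊆ q.1 ∧ EqOn q.2 x I}
  -- This is only a preorder, since values outside the time interval are arbitrary; Zorn's lemma is
  -- used in the form that needs no antisymmetry.
  let r : S → S → Prop := fun q q' => q.1.1 ⊆ q'.1.1 ∧ EqOn q'.1.2 q.1.2 q.1.1
  have : Std.Refl r := ⟨fun q => ⟨Subset.rfl, fun _ _ => rfl⟩⟩
  have htrans : ∀ {q q' q'' : S}, r q q' → r q' q'' → r q q'' := fun h1 h2 =>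
    ⟨h1.1.trans h2.1, fun t ht => (h2.2 (h1.1 ht)).trans (h1.2 ht)⟩
  have hchain : ∀ C : Set S, IsChain r C → ∃ ub, ∀ q ∈ C, r q ub := by
    intro C hC
    rcases C.eq_empty_or_nonempty with rfl | ⟨q₀, hq₀⟩
    · exact ⟨⟨(I, x), h, Subset.rfl, fun _ _ => rfl⟩, by simp⟩
    classical
    let J : Set ℝ := ⋃ q ∈ C, q.1.1
    let y : ℝ → Fin N → ℝ := fun t => if ht : ∃ q ∈ C, t ∈ q.1.1 then ht.choose.1.2 t else 0
    have hy : ∀ q ∈ C, EqOn y q.1.2 q.1.1 := by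
      intro q hq t ht
      have h' : ∃ q ∈ C, t ∈ q.1.1 := ⟨q, hq, ht⟩
      simp only [y, dif_pos h']
      rcases hC.total h'.choose_spec.1 hq with h1 | h1
      · exact (h1.2 h'.choose_spec.2).symm
      · exact h1.2 ht
    have hJ : ∀ q ∈ C, q.1.1 ⊆ J := fun q hq t ht => mem_biUnion hq ht
    have hsol : IsSolution m J y := by
      refine ⟨isOpen_biUnion fun q _ => q.2.1.isOpen, ⟨?_⟩, ?_, ?_, ?_⟩
      · intro a ha b hb
        obtain ⟨q, hq, haq⟩ := mem_iUnion₂.1 ha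
        obtain ⟨q', hq', hbq'⟩ := mem_iUnion₂.1 hb
        rcases hC.total hq hq' with h1 | h1
        · exact (q'.2.1.ordConnected.out (h1.1 haq) hbq').trans (hJ q' hq')
        · exact (q.2.1.ordConnected.out haq (h1.1 hbq')).trans (hJ q hq)
      · exact h.nonempty.mono (q₀.2.2.1.trans (hJ q₀ hq₀))
      · intro t ht
        obtain ⟨q, hq, htq⟩ := mem_iUnion₂.1 ht
        rw [hy q hq htq]
        exact q.2.1.no_multiple t htq
      · intro t ht
        obtain ⟨q, hq, htq⟩ := mem_iUnion₂.1 ht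
        obtain ⟨v, w, h1, h2, h3⟩ := q.2.1.motion t htq
        rw [hy q hq htq]
        refine ⟨v, w, ?_, ?_, h3⟩
        · filter_upwards [h1, (q.2.1.mem_nhds htq).filter_mono nhdsWithin_le_nhds] with s hs hsq
          rw [hy q hq hsq, hs]
        · filter_upwards [h2, (q.2.1.mem_nhds htq).filter_mono nhdsWithin_le_nhds] with s hs hsq
          rw [hy q hq hsq, hs]
    exact ⟨⟨(J, y), hsol, q₀.2.2.1.trans (hJ q₀ hq₀), fun t ht =>
      (hy q₀ hq₀ (q₀.2.2.1 ht)).trans (q₀.2.2.2 ht)⟩, fun q hq => ⟨hJ q hq, hy q hq⟩⟩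
  obtain ⟨q, hq⟩ := exists_maximal_of_chains_bounded (r := r) hchain htrans
  refine ⟨q.1.1, q.1.2, ⟨q.2.1, fun J y hy hJ he => ?_⟩, q.2.2⟩
  exact Subset.antisymm (hq ⟨(J, y), hy, q.2.2.1.trans hJ,
    fun t ht => (he (q.2.2.1 ht)).trans (q.2.2.2 ht)⟩ ⟨hJ, he⟩).1 hJ

theorem collisionTimes_mono {J : Set ℝ} {y : ℝ → Fin N → ℝ} (hI : IsOpen I) (hIJ : I ⊆ J)
    (he : EqOn y x I) : collisionTimes I x ⊆ collisionTimes J y := by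
  rintro t ⟨ht, i, j, hij, hs⟩
  refine ⟨hIJ ht, i, j, by rwa [he ht], ?_⟩
  filter_upwards [hs, mem_nhdsWithin_of_mem_nhds (hI.mem_nhds ht)] with s h1 h2
  rwa [he h2]

/-- Particles at rest far away can be added to a bounded solution. -/
theorem IsSolution.exists_extend {k : ℕ} {σ : Fin k → Fin N} (hσ : Function.Injective σ)
    {x : ℝ → Fin k → ℝ} (h : IsSolution (m ∘ σ) I x) {C : ℝ} (hC : ∀ t ∈ I, ∀ i, x t i ≤ C) :
    ∃ y : ℝ → Fin N → ℝ, IsSolution m I y ∧ ∀ t i, y t (σ i) = x t i := by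
  classical
  let f : (Fin k → ℝ) → (Fin N → ℝ) → Fin N → ℝ := fun a b => Function.extend σ a b
  have hf1 : ∀ a b i, f a b (σ i) = a i := fun a b i => hσ.extend_apply a b i
  have hf2 : ∀ a b j, j ∉ range σ → f a b j = b j := fun a b j hj =>
    Function.extend_apply' a b j hj
  -- The resting places are distinct and to the right of the bound `C`, so the added particles meet
  -- nobody.
  let c : Fin N → ℝ := fun j => C + 1 + (j : ℕ)
  have hc : Function.Injective c := fun i j hij => by
    simpa [c, Fin.ext_iff] using hij
  let y : ℝ → Fin N → ℝ := fun t => f (x t) c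
  have hcase : ∀ j, (∃ i, j = σ i) ∨ j ∉ range σ := fun j => by
    by_cases hj : j ∈ range σ
    · obtain ⟨i, rfl⟩ := hj
      exact Or.inl ⟨i, rfl⟩
    · exact Or.inr hj
  have hlt : ∀ t ∈ I, ∀ i j, j ∉ range σ → y t (σ i) < y t j := fun t ht i j hj => by
    simp only [y, hf1, hf2 _ _ j hj, c]
    have := hC t ht i
    have : (0 : ℝ) ≤ (j : ℕ) := Nat.cast_nonneg _
    linarith
  have hmeet : ∀ t ∈ I, ∀ i j, i ≠ j → y t i = y t j →
      ∃ i' j', i = σ i' ∧ j = σ j' ∧ x t i' = x t j' := fun t ht i j hne hij => by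
    rcases hcase i with ⟨i', rfl⟩ | hi <;> rcases hcase j with ⟨j', rfl⟩ | hj
    · exact ⟨i', j', rfl, rfl, by simpa [y, hf1] using hij⟩
    · exact absurd hij (hlt t ht i' j hj).ne
    · exact absurd hij (hlt t ht j' i hi).ne'
    · simp only [y, hf2 _ _ _ hi, hf2 _ _ _ hj] at hij
      exact absurd (hc hij) hne
  refine ⟨y, ⟨h.isOpen, h.ordConnected, h.nonempty, ?_, ?_⟩, fun t i => hf1 _ _ i⟩
  · intro t ht i j l hij hjl hil he
    obtain ⟨i', j', rfl, rfl, h1⟩ := hmeet t ht i j hij he.1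
    obtain ⟨j'', l', h2, rfl, h3⟩ := hmeet t ht _ l hjl he.2
    obtain rfl := hσ h2
    exact h.no_multiple t ht i' j' l' (fun e => hij (e ▸ rfl)) (fun e => hjl (e ▸ rfl))
      (fun e => hil (e ▸ rfl)) ⟨h1, h3⟩
  · intro t ht
    obtain ⟨v, w, h1, h2, h3⟩ := h.motion t ht
    have aux : ∀ s (a : Fin k → ℝ), x s = x t + (s - t) • a →
        y s = y t + (s - t) • f a 0 := by
      intro s a hs
      ext j
      rcases hcase j with ⟨i, rfl⟩ | hj
      · simp [y, hf1, hs]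
      · simp [y, hf2 _ _ j hj]
    refine ⟨f v 0, f w 0, h1.mono fun s hs => aux s v hs, h2.mono fun s hs => aux s w hs, ?_, ?_⟩
    · intro j hj
      rcases hcase j with ⟨i, rfl⟩ | hj'
      · rw [hf1, hf1]
        refine h3.free i fun l hl he => hj (σ l) (hσ.ne hl) ?_
        simpa [y, hf1] using he
      · rw [hf2 _ _ j hj', hf2 _ _ j hj']
    · intro i j hne hij
      obtain ⟨i', j', rfl, rfl, he⟩ := hmeet t ht i j hne hij
      simp only [hf1]
      exact h3.meeting i' j' (fun e => hne (e ▸ rfl)) he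

theorem collisionTimes_subset_of_comp {k : ℕ} {σ : Fin k → Fin N} {x : ℝ → Fin k → ℝ}
    {y : ℝ → Fin N → ℝ} (hxy : ∀ t i, y t (σ i) = x t i) :
    collisionTimes I x ⊆ collisionTimes I y := by
  rintro t ⟨ht, i, j, hij, hs⟩
  exact ⟨ht, σ i, σ j, by rwa [hxy, hxy], by simpa only [hxy] using hs⟩

end LineParticles

namespace LineParticles
variable {n : ℕ} {m : Fin (n + 2) → ℝ}

/-! ### Ordered configurations -/

/-- The distance from particle `j` to its right neighbour. -/
def gap (j : Fin (n + 1)) : (Fin (n + 2) → ℝ) →ₗ[ℝ] ℝ :=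
  LinearMap.proj (R := ℝ) (φ := fun _ : Fin (n + 2) => ℝ) j.succ - LinearMap.proj j.castSucc

theorem gap_apply (j : Fin (n + 1)) (p : Fin (n + 2) → ℝ) :
    gap j p = p j.succ - p j.castSucc := rfl

theorem monotone_of_gap_nonneg {p : Fin (n + 2) → ℝ} (h : ∀ j, 0 ≤ gap j p) : Monotone p :=
  Fin.monotone_iff_le_succ.2 fun j => sub_nonneg.1 (h j)

theorem injective_of_gap_pos {p : Fin (n + 2) → ℝ} (h : ∀ j, 0 < gap j p) :
    Function.Injective p :=
  (Fin.strictMono_iff_lt_succ.2 fun j => sub_pos.1 (h j)).injective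

/-- In an ordered configuration all gaps between two coincident particles vanish. As only one gap
may vanish, the two are neighbours. -/
theorem exists_gap_eq_zero {p : Fin (n + 2) → ℝ} (h : ∀ j, 0 ≤ gap j p)
    (hone : ∀ i j, gap i p = 0 → gap j p = 0 → i = j) {i l : Fin (n + 2)} (hil : i ≠ l)
    (he : p i = p l) : ∃ j, gap j p = 0 ∧
      ((i = j.castSucc ∧ l = j.succ) ∨ (i = j.succ ∧ l = j.castSucc)) := by
  have hmono := monotone_of_gap_nonneg h
  wlog hlt : i < l generalizing i l
  · obtain ⟨j, hj, h1⟩ := this hil.symm he.symm (lt_of_le_of_ne (not_lt.1 hlt) hil.symm)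
    exact ⟨j, hj, h1.symm.imp And.symm And.symm⟩
  have key : ∀ j : Fin (n + 1), i ≤ j.castSucc → j.succ ≤ l → gap j p = 0 := fun j h1 h2 =>
    le_antisymm (by
      have h3 := hmono h1
      have h4 := hmono h2
      rw [gap_apply]
      linarith) (h j)
  have hi : (i : ℕ) < n + 1 := by have := l.isLt; have : (i : ℕ) < l := hlt; omega
  let j : Fin (n + 1) := ⟨i, hi⟩
  have hj : gap j p = 0 := key j le_rfl (Fin.le_def.2 (by simpa [j] using hlt))
  refine ⟨j, hj, Or.inl ⟨rfl, ?_⟩⟩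
  by_contra hne
  have hne' : (l : ℕ) ≠ i + 1 := fun e => hne (Fin.ext (by simpa [j] using e))
  have hlt' : (i : ℕ) < l := hlt
  have hi' : (i : ℕ) + 1 < n + 1 := by have := l.isLt; omega
  have hj' : gap ⟨i + 1, hi'⟩ p = 0 := key _ (Fin.le_def.2 (by simp))
    (Fin.le_def.2 (by simp only [Fin.val_succ]; omega))
  have := congrArg Fin.val (hone _ _ hj hj')
  simp [j] at this

theorem no_multiple_of_gap {p : Fin (n + 2) → ℝ} (h : ∀ j, 0 ≤ gap j p)
    (hone : ∀ i j, gap i p = 0 → gap j p = 0 → i = j) (i j k : Fin (n + 2)) (hij : i ≠ j)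
    (hjk : j ≠ k) (hik : i ≠ k) : ¬ (p i = p j ∧ p j = p k) := by
  rintro ⟨h1, h2⟩
  obtain ⟨a, ha, h3⟩ := exists_gap_eq_zero h hone hij h1
  obtain ⟨b, hb, h4⟩ := exists_gap_eq_zero h hone hjk h2
  obtain rfl := hone a b ha hb
  rcases h3 with ⟨rfl, rfl⟩ | ⟨rfl, rfl⟩ <;> rcases h4 with ⟨h4, rfl⟩ | ⟨h4, rfl⟩ <;> simp_all

/-- The total mass to the right of the gap `j`. -/
def massAbove (m : Fin (n + 2) → ℝ) (j : Fin (n + 1)) : ℝ := ∑ i ∈ Finset.Ioi j.castSucc, m i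

/-- The configuration with a unit gap after `j` and all other gaps zero. -/
def unitStep (j : Fin (n + 1)) : Fin (n + 2) → ℝ := fun i => if j.castSucc < i then 1 else 0

theorem sum_mul_unitStep (j : Fin (n + 1)) : ∑ i, m i * unitStep j i = massAbove m j := by
  have : (Finset.univ.filter fun i : Fin (n + 2) => j.castSucc < i) = Finset.Ioi j.castSucc := by
    ext i; simp
  simp only [unitStep, mul_ite, mul_one, mul_zero, massAbove, ← Finset.sum_filter, this]

theorem kineticForm_unitStep (i j : Fin (n + 1)) :
    kineticForm m (unitStep i) (unitStep j) = massAbove m (max i j) := by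
  rw [kineticForm_apply, ← sum_mul_unitStep]
  refine Finset.sum_congr rfl fun k _ => ?_
  have : (max i j).castSucc < k ↔ i.castSucc < k ∧ j.castSucc < k := by
    simp only [Fin.lt_def, Fin.val_castSucc, Fin.coe_max, max_lt_iff]
  by_cases h1 : i.castSucc < k <;> by_cases h2 : j.castSucc < k <;> simp [unitStep, this, h1, h2]

theorem eq_sum_gap (x : Fin (n + 2) → ℝ) :
    x = x 0 • (1 : Fin (n + 2) → ℝ) + ∑ j, gap j x • unitStep j := by
  ext i
  simp only [Pi.add_apply, Pi.smul_apply, Pi.one_apply, smul_eq_mul, mul_one, Finset.sum_apply]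
  induction i using Fin.induction with
  | zero => simp [unitStep]
  | succ k ih =>
    have h1 : ∀ j : Fin (n + 1), gap j x * unitStep j k.succ =
        gap j x * unitStep j k.castSucc + if j = k then gap j x else 0 := fun j => by
      rcases lt_trichotomy j k with h | h | h
      · have h2 : j.castSucc < k.succ :=
          (Fin.castSucc_lt_castSucc_iff.2 h).trans k.castSucc_lt_succ
        simp [unitStep, h, h2, h.ne]
      · subst h
        simp [unitStep, j.castSucc_lt_succ]
      · have h2 : ¬ j.castSucc < k.succ := by
          simp only [Fin.lt_def, Fin.val_castSucc, Fin.val_succ] at h ⊢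
          omega
        simp [unitStep, h2, h.ne', h.le]
    simp only [h1, Finset.sum_add_distrib, Finset.sum_ite_eq', Finset.mem_univ, if_true]
    rw [← add_assoc, ← ih, gap_apply]
    ring

/-- The momentum functional. -/
def momentum (m : Fin (n + 2) → ℝ) : (Fin (n + 2) → ℝ) →ₗ[ℝ] ℝ := kineticForm m 1

theorem momentum_apply (x : Fin (n + 2) → ℝ) : momentum m x = ∑ i, m i * x i := by
  simp [momentum, kineticForm_apply]

theorem momentum_eq (x : Fin (n + 2) → ℝ) :
    momentum m x = x 0 * totalMass m + ∑ j, gap j x * massAbove m j := by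
  conv_lhs => rw [eq_sum_gap x]
  simp only [map_add, map_smul, map_sum, smul_eq_mul]
  congr 1
  · simp [momentum_apply, totalMass]
  · simp only [momentum_apply, sum_mul_unitStep]

/-- The kinetic form of a vector relative to the center of mass. -/
noncomputable def relativeEnergy (m x : Fin (n + 2) → ℝ) : ℝ :=
  kineticForm m x x - momentum m x ^ 2 / totalMass m

/-- Conditions on the masses of particles in the given order under which the ordered configurations
are contained in a half-cone of the kinetic form. -/
structure Confining (m : Fin (n + 2) → ℝ) : Prop where
  above : ∀ j, 0 < massAbove m j * totalMass m
  below : ∀ j, totalMass m ≤ massAbove m j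
  coeff : collisionCoeff m 0 1 < 0

theorem Confining.totalMass_ne_zero (hc : Confining m) : totalMass m ≠ 0 := fun h => by
  have := hc.above 0
  simp [h] at this

/-- In the gap coordinates the relative energy is a quadratic form with entries $A_j(M-A_i)/M$ for
$i\le j$, where $A_j$ is the mass above gap $j$. The conditions `above` and `below` make all of them
nonpositive. -/
theorem Confining.relativeEnergy_nonpos (hc : Confining m) {x : Fin (n + 2) → ℝ}
    (hx : ∀ j, 0 ≤ gap j x) : relativeEnergy m x ≤ 0 := by
  have hM := hc.totalMass_ne_zero
  have h1 : kineticForm m x x = x 0 ^ 2 * totalMass m +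
      2 * x 0 * (∑ j, gap j x * massAbove m j) +
      ∑ i, ∑ j, gap i x * gap j x * massAbove m (max i j) := by
    have e1 : kineticForm m 1 1 = totalMass m := by simp [kineticForm_apply, totalMass]
    have e2 : ∀ j, kineticForm m 1 (unitStep j) = massAbove m j := fun j => by
      rw [← sum_mul_unitStep]; simp [kineticForm_apply]
    have e3 : ∀ j, kineticForm m (unitStep j) 1 = massAbove m j := fun j => by
      rw [kineticForm_comm, e2]
    conv_lhs => rw [eq_sum_gap x]
    simp only [map_add, map_smul, map_sum, LinearMap.add_apply, LinearMap.smul_apply,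
      LinearMap.sum_apply, smul_eq_mul, e1, e2, e3, kineticForm_unitStep]
    have e4 : ∑ i, gap i x * (x 0 * massAbove m i + ∑ j, gap j x * massAbove m (max j i)) =
        x 0 * (∑ j, gap j x * massAbove m j) +
          ∑ i, ∑ j, gap i x * gap j x * massAbove m (max i j) := by
      rw [Finset.mul_sum, ← Finset.sum_add_distrib]
      refine Finset.sum_congr rfl fun i _ => ?_
      rw [mul_add, Finset.mul_sum]
      congr 1
      · ring
      · refine Finset.sum_congr rfl fun j _ => ?_
        rw [max_comm]
        ring
    rw [e4]
    ring
  have h2 : relativeEnergy m x = ∑ i, ∑ j, gap i x * gap j x *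
      (massAbove m (max i j) - massAbove m i * massAbove m j / totalMass m) := by
    have e5 : (∑ j, gap j x * massAbove m j) ^ 2 =
        ∑ i, ∑ j, gap i x * gap j x * (massAbove m i * massAbove m j) := by
      rw [sq, Finset.sum_mul_sum]
      exact Finset.sum_congr rfl fun i _ => Finset.sum_congr rfl fun j _ => by ring
    have e6 : ∑ i, ∑ j, gap i x * gap j x *
        (massAbove m (max i j) - massAbove m i * massAbove m j / totalMass m) =
        (∑ i, ∑ j, gap i x * gap j x * massAbove m (max i j)) -
        (∑ j, gap j x * massAbove m j) ^ 2 / totalMass m := by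
      rw [e5, Finset.sum_div, ← Finset.sum_sub_distrib]
      refine Finset.sum_congr rfl fun i _ => ?_
      rw [Finset.sum_div, ← Finset.sum_sub_distrib]
      exact Finset.sum_congr rfl fun j _ => by ring
    rw [e6, relativeEnergy, h1, momentum_eq]
    field_simp
    ring
  have key : ∀ i j : Fin (n + 1), i ≤ j →
      massAbove m j - massAbove m i * massAbove m j / totalMass m ≤ 0 := by
    intro i j _
    have e : massAbove m j - massAbove m i * massAbove m j / totalMass m =
        (massAbove m j * totalMass m) * (totalMass m - massAbove m i) / totalMass m ^ 2 := by
      field_simp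
    rw [e]
    exact div_nonpos_of_nonpos_of_nonneg (mul_nonpos_of_nonneg_of_nonpos (hc.above j).le
      (sub_nonpos.2 (hc.below i))) (sq_nonneg _)
  rw [h2]
  refine Finset.sum_nonpos fun i _ => Finset.sum_nonpos fun j _ =>
    mul_nonpos_of_nonneg_of_nonpos (mul_nonneg (hx i) (hx j)) ?_
  rcases le_total i j with h | h
  · rw [max_eq_right h]; exact key i j h
  · rw [max_eq_left h, mul_comm (massAbove m i)]; exact key j i h

/-- Momentum times $M$ is $x_0M^2+\sum_j \mathrm{gap}_j\,A_jM$ with positive weights. Hence fixed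
momentum bounds $x_0$ above, and a lower bound for $x_0$ bounds every gap. -/
theorem Confining.exists_bound (hc : Confining m) (P K : ℝ) : ∃ C, ∀ x : Fin (n + 2) → ℝ,
    (∀ j, 0 ≤ gap j x) → momentum m x = P → K ≤ x 0 → ∀ i, x i ≤ C := by
  have hM := hc.totalMass_ne_zero
  have hM2 : 0 < totalMass m ^ 2 := by positivity
  set D := P * totalMass m - K * totalMass m ^ 2 with hD
  refine ⟨P * totalMass m / totalMass m ^ 2 + ∑ j, D / (massAbove m j * totalMass m),
    fun x hx hP hK i => ?_⟩
  have h1 : ∑ j, gap j x * (massAbove m j * totalMass m) =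
      P * totalMass m - x 0 * totalMass m ^ 2 := by
    rw [← hP, momentum_eq, add_mul, Finset.sum_mul]
    simp only [mul_assoc]
    ring
  have hnn : ∀ j, 0 ≤ gap j x * (massAbove m j * totalMass m) := fun j =>
    mul_nonneg (hx j) (hc.above j).le
  have h2 : ∀ j, gap j x ≤ D / (massAbove m j * totalMass m) := fun j => by
    rw [le_div_iff₀ (hc.above j)]
    have h3 := Finset.single_le_sum (fun j _ => hnn j) (Finset.mem_univ j)
    have h4 := mul_le_mul_of_nonneg_right hK hM2.le
    linarith
  have h3 : x 0 ≤ P * totalMass m / totalMass m ^ 2 := by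
    rw [le_div_iff₀ hM2]
    have := Finset.sum_nonneg fun j (_ : j ∈ Finset.univ) => hnn j
    linarith
  have h4 := congrFun (eq_sum_gap x) i
  simp only [Pi.add_apply, Pi.smul_apply, Pi.one_apply, smul_eq_mul, mul_one,
    Finset.sum_apply] at h4
  rw [h4]
  refine add_le_add h3 (Finset.sum_le_sum fun j _ => le_trans ?_ (h2 j))
  unfold unitStep
  split_ifs
  · simp
  · simpa using hx j

/-! ### Reflections in the walls of the chamber of ordered configurations -/

/-- The change of positions in a unit collision of `j` with its right neighbour. -/
noncomputable def kick (m : Fin (n + 2) → ℝ) (j : Fin (n + 1)) : Fin (n + 2) → ℝ :=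
  Pi.single j.castSucc (collisionCoeff m j.castSucc j.succ) -
    Pi.single j.succ (collisionCoeff m j.succ j.castSucc)

/-- The reflection describing a collision of `j` with its right neighbour. -/
noncomputable def reflect (m : Fin (n + 2) → ℝ) (j : Fin (n + 1)) :
    (Fin (n + 2) → ℝ) →ₗ[ℝ] (Fin (n + 2) → ℝ) :=
  LinearMap.id + (gap j).smulRight (kick m j)

theorem reflect_apply (j : Fin (n + 1)) (x : Fin (n + 2) → ℝ) :
    reflect m j x = x + gap j x • kick m j := rfl

theorem castSucc_ne_succ (j : Fin (n + 1)) : j.castSucc ≠ j.succ := j.castSucc_lt_succ.ne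

theorem gap_reflect (hpair : ∀ i j, i ≠ j → m i + m j ≠ 0) (j : Fin (n + 1))
    (x : Fin (n + 2) → ℝ) : gap j (reflect m j x) = -gap j x := by
  have h := collisionCoeff_add j.castSucc j.succ (hpair _ _ (castSucc_ne_succ j))
  have h1 : gap j (kick m j) = -2 := by
    simp only [gap_apply, kick, Pi.sub_apply, Pi.single_eq_same,
      Pi.single_eq_of_ne (castSucc_ne_succ j), Pi.single_eq_of_ne (castSucc_ne_succ j).symm]
    linarith
  rw [reflect_apply, map_add, map_smul, h1, smul_eq_mul]
  ring

theorem reflect_reflect (hpair : ∀ i j, i ≠ j → m i + m j ≠ 0) (j : Fin (n + 1))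
    (x : Fin (n + 2) → ℝ) : reflect m j (reflect m j x) = x := by
  rw [reflect_apply, gap_reflect hpair, reflect_apply]
  module

theorem kineticForm_kick (j : Fin (n + 1)) (x : Fin (n + 2) → ℝ) :
    kineticForm m (kick m j) x =
      -(m j.castSucc * collisionCoeff m j.castSucc j.succ) * gap j x := by
  have h := mul_collisionCoeff m j.castSucc j.succ
  simp only [kineticForm_apply, kick, Pi.sub_apply, sub_mul, Finset.sum_sub_distrib,
    Pi.single_apply, ite_mul, zero_mul, Finset.sum_ite_eq', Finset.mem_univ, if_true, gap_apply]
  linear_combination x j.succ * h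

theorem kineticForm_reflect (hpair : ∀ i j, i ≠ j → m i + m j ≠ 0) (j : Fin (n + 1))
    (x : Fin (n + 2) → ℝ) :
    kineticForm m (reflect m j x) (reflect m j x) = kineticForm m x x := by
  have h1 := gap_reflect hpair j x
  rw [reflect_apply, map_add, map_smul, smul_eq_mul] at h1
  rw [reflect_apply]
  simp only [map_add, map_smul, LinearMap.add_apply, LinearMap.smul_apply, smul_eq_mul,
    kineticForm_comm m x (kick m j), kineticForm_kick]
  linear_combination (-(m j.castSucc * collisionCoeff m j.castSucc j.succ) * gap j x) * h1

theorem momentum_reflect (j : Fin (n + 1)) (x : Fin (n + 2) → ℝ) :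
    momentum m (reflect m j x) = momentum m x := by
  have h : momentum m (kick m j) = 0 := by
    rw [momentum, kineticForm_comm, kineticForm_kick, gap_apply]
    simp
  rw [reflect_apply, map_add, map_smul, h, smul_zero, add_zero]

/-- A product of reflections. -/
noncomputable def reflectWord (m : Fin (n + 2) → ℝ) :
    List (Fin (n + 1)) → (Fin (n + 2) → ℝ) →ₗ[ℝ] (Fin (n + 2) → ℝ)
  | [] => LinearMap.id
  | j :: l => reflect m j ∘ₗ reflectWord m l

theorem reflectWord_surjective (hpair : ∀ i j, i ≠ j → m i + m j ≠ 0) :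
    ∀ l : List (Fin (n + 1)), Function.Surjective (reflectWord m l)
  | [] => Function.surjective_id
  | j :: l => (Function.LeftInverse.surjective (reflect_reflect hpair j)).comp
      (reflectWord_surjective hpair l)

theorem momentum_reflectWord (x : Fin (n + 2) → ℝ) :
    ∀ l : List (Fin (n + 1)), momentum m (reflectWord m l x) = momentum m x
  | [] => rfl
  | j :: l => (momentum_reflect j _).trans (momentum_reflectWord x l)

theorem kineticForm_reflectWord (hpair : ∀ i j, i ≠ j → m i + m j ≠ 0) (x : Fin (n + 2) → ℝ) :
    ∀ l : List (Fin (n + 1)), kineticForm m (reflectWord m l x) (reflectWord m l x) =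
      kineticForm m x x
  | [] => rfl
  | j :: l => (kineticForm_reflect hpair j _).trans (kineticForm_reflectWord hpair x l)

theorem CollisionLaw.unique {N : ℕ} {m p v w w' : Fin N → ℝ} (h : CollisionLaw m p v w)
    (h' : CollisionLaw m p v w') : w = w' := by
  ext i
  by_cases hi : ∀ j, j ≠ i → p j ≠ p i
  · rw [h.free i hi, h'.free i hi]
  · push Not at hi
    obtain ⟨j, hj, he⟩ := hi
    rw [h.meeting i j hj.symm he.symm, h'.meeting i j hj.symm he.symm]

theorem CollisionLaw.of_injective {N : ℕ} {m p : Fin N → ℝ} (hp : Function.Injective p)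
    (v : Fin N → ℝ) : CollisionLaw m p v v :=
  ⟨fun _ _ => rfl, fun _ _ hij he => (hij (hp he)).elim⟩

theorem collisionLaw_reflect {p : Fin (n + 2) → ℝ} (h : ∀ j, 0 ≤ gap j p)
    (hone : ∀ i j, gap i p = 0 → gap j p = 0 → i = j) {j : Fin (n + 1)} (hj : gap j p = 0)
    (v : Fin (n + 2) → ℝ) : CollisionLaw m p v (reflect m j v) := by
  have hj' : p j.succ = p j.castSucc := sub_eq_zero.1 hj
  refine ⟨fun i hi => ?_, fun i l hil he => ?_⟩
  · have h1 : i ≠ j.castSucc := by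
      rintro rfl
      exact hi j.succ (castSucc_ne_succ j).symm hj'
    have h2 : i ≠ j.succ := by
      rintro rfl
      exact hi j.castSucc (castSucc_ne_succ j) hj'.symm
    simp [reflect_apply, kick, Pi.single_eq_of_ne h1, Pi.single_eq_of_ne h2]
  · obtain ⟨k, hk, h1⟩ := exists_gap_eq_zero h hone hil he
    obtain rfl := hone j k hj hk
    rcases h1 with ⟨rfl, rfl⟩ | ⟨rfl, rfl⟩
    · simp only [reflect_apply, kick, Pi.add_apply, Pi.smul_apply, Pi.sub_apply,
        Pi.single_eq_same, Pi.single_eq_of_ne hil, smul_eq_mul, gap_apply]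
      ring
    · simp only [reflect_apply, kick, Pi.add_apply, Pi.smul_apply, Pi.sub_apply,
        Pi.single_eq_same, Pi.single_eq_of_ne hil, smul_eq_mul, gap_apply]
      ring

/-- Only gap 0 affects the leftmost particle, and there `coeff` and the closing gap are both
nonpositive. So collisions never push this particle to the left. -/
theorem Confining.le_reflect_zero (hc : Confining m) {j : Fin (n + 1)} {v : Fin (n + 2) → ℝ}
    (hv : gap j v ≤ 0) : v 0 ≤ reflect m j v 0 := by
  rw [reflect_apply, Pi.add_apply, Pi.smul_apply, smul_eq_mul, kick, Pi.sub_apply,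
    Pi.single_eq_of_ne (Fin.succ_ne_zero j).symm, sub_zero]
  rcases eq_or_ne j 0 with rfl | hj
  · rw [Fin.castSucc_zero, Pi.single_eq_same]
    have := mul_nonneg_of_nonpos_of_nonpos hv hc.coeff.le
    simpa using this
  · rw [Pi.single_eq_of_ne fun e => hj (Fin.castSucc_eq_zero_iff.1 e.symm)]
    simp

/-! ### Generic initial positions -/

/-- The unfolded motion from `a` with velocity `v` never meets two walls at the same time. -/
def Generic (m a v : Fin (n + 2) → ℝ) : Prop :=
  ∀ (l : List (Fin (n + 1))) (t : ℝ) (i j : Fin (n + 1)),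
    gap i (reflectWord m l (a + t • v)) = 0 → gap j (reflectWord m l (a + t • v)) = 0 → i = j

/-- For each word and each pair of distinct walls, eliminating the time confines the bad `a` to a
hyperplane. Words are countable, so the bad set is null, whereas the open chamber has positive
measure. -/
theorem exists_generic (hpair : ∀ i j, i ≠ j → m i + m j ≠ 0) (v : Fin (n + 2) → ℝ) :
    ∃ a, (∀ j, 0 < gap j a) ∧ Generic m a v := by
  have key : ∀ (l : List (Fin (n + 1))) (i j : Fin (n + 1)), i ≠ j →
      ∃ f : (Fin (n + 2) → ℝ) →ₗ[ℝ] ℝ, f ≠ 0 ∧ ∀ a, (∃ t : ℝ,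
        gap i (reflectWord m l (a + t • v)) = 0 ∧ gap j (reflectWord m l (a + t • v)) = 0) →
        f a = 0 := by
    intro l i j hij
    -- The vectors `unitStep k` are dual to the gaps; this gives the independence of `f₁` and `f₂`
    -- below.
    have hex : ∀ k : Fin (n + 1), ∃ y, ∀ k', gap k' (reflectWord m l y) =
        if k = k' then 1 else 0 := fun k => by
      obtain ⟨y, hy⟩ := reflectWord_surjective hpair l (unitStep k)
      refine ⟨y, fun k' => ?_⟩
      rw [hy, gap_apply]
      rcases lt_trichotomy k k' with h | h | h
      · simp only [unitStep, Fin.lt_def, Fin.val_castSucc, Fin.val_succ, if_neg h.ne] at h ⊢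
        rw [if_pos (by omega), if_pos h, sub_self]
      · subst h
        simp [unitStep, k.castSucc_lt_succ]
      · simp only [unitStep, Fin.lt_def, Fin.val_castSucc, Fin.val_succ, if_neg h.ne'] at h ⊢
        rw [if_neg (by omega), if_neg (by omega), sub_self]
    obtain ⟨y, hy⟩ := hex i
    obtain ⟨z, hz⟩ := hex j
    let f₁ := gap i ∘ₗ reflectWord m l
    let f₂ := gap j ∘ₗ reflectWord m l
    have hy1 : f₁ y = 1 := by simp [f₁, hy]
    have hy2 : f₂ y = 0 := by simp [f₂, hy, hij]
    have hz1 : f₁ z = 0 := by simp [f₁, hz, hij.symm]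
    have hz2 : f₂ z = 1 := by simp [f₂, hz]
    by_cases h0 : f₁ v = 0
    · refine ⟨f₁, fun e => by simp [e] at hy1, fun a => ?_⟩
      rintro ⟨t, h1, -⟩
      change f₁ (a + t • v) = 0 at h1
      simpa [h0] using h1
    · refine ⟨f₂ v • f₁ - f₁ v • f₂, fun e => h0 ?_, fun a => ?_⟩
      · have := LinearMap.congr_fun e z
        simpa [hz1, hz2] using this
      · rintro ⟨t, h1, h2⟩
        change f₁ (a + t • v) = 0 at h1
        change f₂ (a + t • v) = 0 at h2
        rw [map_add, map_smul, smul_eq_mul] at h1 h2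
        simp only [LinearMap.sub_apply, LinearMap.smul_apply, smul_eq_mul]
        linear_combination f₂ v * h1 - f₁ v * h2
  choose! f hf0 hf using key
  let bad : Set (Fin (n + 2) → ℝ) := ⋃ q : List (Fin (n + 1)) × Fin (n + 1) × Fin (n + 1),
    if q.2.1 = q.2.2 then ∅ else (LinearMap.ker (f q.1 q.2.1 q.2.2) : Set (Fin (n + 2) → ℝ))
  have hbad : MeasureTheory.volume bad = 0 := by
    refine MeasureTheory.measure_iUnion_null fun q => ?_
    split_ifs with hq
    · simp
    · exact MeasureTheory.Measure.addHaar_submodule _ _ fun e =>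
        hf0 _ _ _ hq (LinearMap.ker_eq_top.1 e)
  let U : Set (Fin (n + 2) → ℝ) := {a | ∀ j, 0 < gap j a}
  have hU : IsOpen U := by
    simp only [U, Set.ofPred_forall]
    exact isOpen_iInter_of_finite fun j =>
      isOpen_lt continuous_const (LinearMap.continuous_of_finiteDimensional _)
  have hUne : U.Nonempty := ⟨fun i => (i : ℕ), fun j => by simp [gap_apply]⟩
  have hUpos := hU.measure_pos MeasureTheory.volume hUne
  obtain ⟨a, haU, ha⟩ : ∃ a ∈ U, a ∉ bad := by
    by_contra! hcon
    exact hUpos.ne' (MeasureTheory.measure_mono_null hcon hbad)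
  refine ⟨a, haU, fun l t i j h1 h2 => ?_⟩
  by_contra hij
  refine ha (mem_iUnion.2 ⟨(l, i, j), ?_⟩)
  simp only [if_neg hij]
  exact hf l i j hij a ⟨t, h1, h2⟩

end LineParticles

namespace LineParticles

/-! ### Continuing a solution past a collision -/

theorem IsSolution.exists_continuation {N : ℕ} {m : Fin N → ℝ} {I : Set ℝ} {x : ℝ → Fin N → ℝ}
    (h : IsSolution m I x) {b c d : ℝ} {p v w : Fin N → ℝ} (hcb : c < b) (hbd : b < d)
    (hIb : ∀ t ∈ I, t < b) (hcI : Ioo c b ⊆ I) (hx : ∀ t ∈ Ioo c b, x t = p + (t - b) • v)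
    (hp : ∀ i j k : Fin N, i ≠ j → j ≠ k → i ≠ k → ¬ (p i = p j ∧ p j = p k))
    (hl : CollisionLaw m p v w)
    (hinj : ∀ t ∈ Ioo b d, Function.Injective (p + (t - b) • w)) :
    ∃ (J : Set ℝ) (y : ℝ → Fin N → ℝ), IsSolution m J y ∧ I ⊆ J ∧ EqOn y x I ∧ b ∈ J := by
  classical
  let y : ℝ → Fin N → ℝ := fun t => if t < b then x t else p + (t - b) • w
  have hy1 : ∀ t, t < b → y t = x t := fun t ht => if_pos ht
  have hy2 : ∀ t, b ≤ t → y t = p + (t - b) • w := fun t ht => if_neg (not_lt.2 ht)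
  have hyb : y b = p := by simp [hy2 b le_rfl]
  have hJI : ∀ t ∈ I ∪ Ioo c d, t < b → t ∈ I := fun t ht htb =>
    ht.elim id fun h' => hcI ⟨h'.1, htb⟩
  have hJd : ∀ t ∈ I ∪ Ioo c d, b < t → t < d := fun t ht htb =>
    ht.elim (fun h' => absurd (hIb t h') (not_lt.2 htb.le)) fun h' => h'.2
  refine ⟨I ∪ Ioo c d, y, ⟨h.isOpen.union isOpen_Ioo, ?_, h.nonempty.mono subset_union_left,
    fun t ht => ?_, fun t ht => ?_⟩, subset_union_left, fun t ht => hy1 t (hIb t ht),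
    Or.inr ⟨hcb, hbd⟩⟩
  · obtain ⟨e, he⟩ := exists_between hcb
    exact (IsPreconnected.union e (hcI he) (show e ∈ Ioo c d from ⟨he.1, he.2.trans hbd⟩)
      (isPreconnected_iff_ordConnected.2 h.ordConnected) isPreconnected_Ioo).ordConnected
  · rcases lt_trichotomy t b with htb | rfl | htb
    · rw [hy1 t htb]
      exact h.no_multiple t (hJI t ht htb)
    · rwa [hyb]
    · intro i j k hij _ _ he
      rw [hy2 t htb.le] at he
      exact hij (hinj t ⟨htb, hJd t ht htb⟩ he.1)
  · rcases lt_trichotomy t b with htb | rfl | htb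
    · obtain ⟨v', w', h1, h2, h3⟩ := h.motion t (hJI t ht htb)
      have hev : ∀ᶠ s in 𝓝 t, s < b := eventually_lt_nhds htb
      rw [hy1 t htb]
      refine ⟨v', w', ?_, ?_, h3⟩
      · filter_upwards [h1, hev.filter_mono nhdsWithin_le_nhds] with s hs hsb
        rw [hy1 s hsb, hs]
      · filter_upwards [h2, hev.filter_mono nhdsWithin_le_nhds] with s hs hsb
        rw [hy1 s hsb, hs]
    · refine ⟨v, w, ?_, ?_, by rwa [hyb]⟩
      · have hev : ∀ᶠ s in 𝓝 t, c < s := eventually_gt_nhds hcb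
        filter_upwards [self_mem_nhdsWithin, hev.filter_mono nhdsWithin_le_nhds] with s hs hsc
        rcases (show s ≤ t from hs).lt_or_eq with hs' | rfl
        · rw [hy1 s hs', hyb, hx s ⟨hsc, hs'⟩]
        · simp
      · filter_upwards [self_mem_nhdsWithin] with s hs
        rw [hy2 s hs, hyb]
    · have hev : ∀ᶠ s in 𝓝 t, b < s := eventually_gt_nhds htb
      have aux : ∀ᶠ s in 𝓝 t, y s = y t + (s - t) • w := by
        filter_upwards [hev] with s hs
        rw [hy2 s hs.le, hy2 t htb.le]
        module
      refine ⟨w, w, aux.filter_mono nhdsWithin_le_nhds, aux.filter_mono nhdsWithin_le_nhds, ?_⟩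
      rw [hy2 t htb.le]
      exact CollisionLaw.of_injective (hinj t ⟨htb, hJd t ht htb⟩) w

variable {n : ℕ} {m : Fin (n + 2) → ℝ} {a v p w : Fin (n + 2) → ℝ} {t s : ℝ}

/-! ### Motion inside the chamber of ordered configurations -/

theorem eventually_gap_pos (hp : ∀ j, 0 ≤ gap j p) (hw : ∀ j, 0 < gap j p ∨ 0 < gap j w) :
    ∀ᶠ s in 𝓝[>] t, ∀ j, 0 < gap j (p + (s - t) • w) := by
  refine eventually_all.2 fun j => ?_
  have hlin : ∀ s : ℝ, gap j (p + (s - t) • w) = gap j p + (s - t) * gap j w := fun s => by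
    rw [map_add, map_smul, smul_eq_mul]
  simp only [hlin]
  rcases (hp j).lt_or_eq with h0 | h0
  · have : Continuous fun s : ℝ => gap j p + (s - t) * gap j w := by fun_prop
    have h1 := this.tendsto t
    simp only [sub_self, zero_mul, add_zero] at h1
    exact (h1.eventually (eventually_gt_nhds h0)).filter_mono nhdsWithin_le_nhds
  · have hwj : 0 < gap j w := (hw j).resolve_left (by rw [← h0]; exact lt_irrefl _)
    filter_upwards [self_mem_nhdsWithin] with s hs
    rw [← h0, zero_add]
    exact mul_pos (sub_pos.2 hs) hwj

/-- The position `p` and the velocity `w` at time `t` of a motion in the chamber of ordered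
configurations which is the folding of the straight motion from `a` with velocity `v`. -/
structure Folded (m a v : Fin (n + 2) → ℝ) (t : ℝ) (p w : Fin (n + 2) → ℝ) : Prop where
  exists_word : ∃ l, p = reflectWord m l (a + t • v) ∧ w = reflectWord m l v
  gap_nonneg : ∀ j, 0 ≤ gap j p
  gap_pos : ∀ j, 0 < gap j p ∨ 0 < gap j w
  le_velocity : v 0 ≤ w 0
  le_position : a 0 + t * v 0 ≤ p 0

namespace Folded

theorem initial (ha : ∀ j, 0 < gap j a) : Folded m a v 0 a v :=
  ⟨⟨[], by simp [reflectWord], rfl⟩, fun j => (ha j).le, fun j => Or.inl (ha j), le_rfl,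
    by simp⟩

theorem unfold_add {l : List (Fin (n + 1))} (h1 : p = reflectWord m l (a + t • v))
    (h2 : w = reflectWord m l v) :
    p + (s - t) • w = reflectWord m l (a + s • v) := by
  rw [h1, h2, ← map_smul, ← map_add]
  congr 1
  module

theorem eventually_right (h : Folded m a v t p w) :
    ∀ᶠ s in 𝓝[>] t, Folded m a v s (p + (s - t) • w) w := by
  filter_upwards [eventually_gap_pos h.gap_nonneg h.gap_pos, self_mem_nhdsWithin] with s hs hst
  have hst' : 0 ≤ s - t := sub_nonneg.2 (le_of_lt hst)
  obtain ⟨l, h1, h2⟩ := h.exists_word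
  refine ⟨⟨l, unfold_add h1 h2, h2⟩, fun j => (hs j).le, fun j => Or.inl (hs j), h.le_velocity, ?_⟩
  have h3 := h.le_position
  have h4 := mul_le_mul_of_nonneg_left h.le_velocity hst'
  simp only [Pi.add_apply, Pi.smul_apply, smul_eq_mul]
  linarith

theorem gap_eq_zero_unique (hgen : Generic m a v) {l : List (Fin (n + 1))}
    (hp : p = reflectWord m l (a + t • v)) (i j : Fin (n + 1)) (hi : gap i p = 0)
    (hj : gap j p = 0) : i = j :=
  hgen l t i j (hp ▸ hi) (hp ▸ hj)

/-- By genericity a straight flight reaches at most one wall at time `t`. One reflection then turns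
it back into the chamber and adds one letter to the word. -/
theorem exists_outgoing (hpair : ∀ i j, i ≠ j → m i + m j ≠ 0) (hc : Confining m)
    (hgen : Generic m a v) (hst : s < t) (h : Folded m a v s (p + (s - t) • w) w)
    (hp : ∀ j, 0 ≤ gap j p) :
    (∀ i j, gap i p = 0 → gap j p = 0 → i = j) ∧
      ∃ w', CollisionLaw m p w w' ∧ Folded m a v t p w' := by
  obtain ⟨l, h1, h2⟩ := h.exists_word
  have h3 : p = reflectWord m l (a + t • v) := by
    rw [← unfold_add h1 h2]
    module
  have hone := gap_eq_zero_unique hgen h3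
  -- At the earlier time `s` this gap is `(s - t) * gap j w`, which is nonnegative, and `gap_pos`
  -- excludes that it is identically zero.
  have hneg : ∀ j, gap j p = 0 → gap j w < 0 := fun j hj => by
    have e : gap j (p + (s - t) • w) = (s - t) * gap j w := by
      rw [map_add, map_smul, hj, zero_add, smul_eq_mul]
    have h4 := h.gap_nonneg j
    have h5 := h.gap_pos j
    rw [e] at h4 h5
    by_contra hcon
    rcases (not_lt.1 hcon).lt_or_eq with h6 | h6
    · nlinarith
    · rw [← h6, mul_zero] at h5
      exact h5.elim (lt_irrefl _) (lt_irrefl _)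
  have hpos : a 0 + t * v 0 ≤ p 0 := by
    have h4 := h.le_position
    simp only [Pi.add_apply, Pi.smul_apply, smul_eq_mul] at h4
    have h5 := mul_le_mul_of_nonneg_left h.le_velocity (sub_nonneg.2 hst.le)
    linarith
  refine ⟨hone, ?_⟩
  by_cases hz : ∃ j, gap j p = 0
  · obtain ⟨j, hj⟩ := hz
    refine ⟨reflect m j w, collisionLaw_reflect hp hone hj w, ⟨j :: l, ?_, ?_⟩, hp, fun i => ?_,
      h.le_velocity.trans (hc.le_reflect_zero (hneg j hj).le), hpos⟩
    · change p = reflect m j (reflectWord m l (a + t • v))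
      rw [← h3, reflect_apply, hj, zero_smul, add_zero]
    · change _ = reflect m j (reflectWord m l v)
      rw [← h2]
    · rcases eq_or_ne i j with rfl | hij
      · exact Or.inr (by rw [gap_reflect hpair]; exact neg_pos.2 (hneg i hj))
      · exact Or.inl (lt_of_le_of_ne (hp i) fun e => hij (hone i j e.symm hj))
  · push Not at hz
    have hgp : ∀ j, 0 < gap j p := fun j => lt_of_le_of_ne (hp j) (hz j).symm
    exact ⟨w, CollisionLaw.of_injective (injective_of_gap_pos hgp) w, ⟨l, h3, h2⟩, hp,
      fun j => Or.inl (hgp j), h.le_velocity, hpos⟩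

/-- Reflections preserve form and momentum, so the relative energy can be computed on the unfolded
line. -/
theorem relativeEnergy_eq (hpair : ∀ i j, i ≠ j → m i + m j ≠ 0) (hv : momentum m v = 0)
    (h : Folded m a v t p w) : relativeEnergy m p =
      relativeEnergy m a + 2 * t * kineticForm m a v + t ^ 2 * kineticForm m v v := by
  obtain ⟨l, h1, -⟩ := h.exists_word
  rw [h1, relativeEnergy, kineticForm_reflectWord hpair, momentum_reflectWord, relativeEnergy]
  have := kineticForm_comm m v a
  simp only [map_add, map_smul, hv, LinearMap.add_apply, LinearMap.smul_apply, smul_eq_mul]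
  rw [this]
  ring

theorem momentum_eq (hv : momentum m v = 0) (h : Folded m a v t p w) :
    momentum m p = momentum m a := by
  obtain ⟨l, h1, -⟩ := h.exists_word
  rw [h1, momentum_reflectWord, map_add, map_smul, hv, smul_zero, add_zero]

end Folded

theorem gap_nonneg_of_frequently {x : ℝ → Fin (n + 2) → ℝ} {f : Filter ℝ}
    (hx : Tendsto x f (𝓝 p)) (h : ∃ᶠ s in f, ∀ j, 0 ≤ gap j (x s)) (j : Fin (n + 1)) :
    0 ≤ gap j p := by
  by_contra hcon
  have hcont : Continuous (gap j) := LinearMap.continuous_of_finiteDimensional _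
  have h1 := ((hcont.tendsto p).comp hx).eventually (eventually_lt_nhds (not_le.1 hcon))
  obtain ⟨s, h2, h3⟩ := (h.and_eventually h1).exists
  exact absurd h3 (not_lt.2 (h2 j))

theorem IsSolution.folded (hpair : ∀ i j, i ≠ j → m i + m j ≠ 0) (hc : Confining m)
    (hgen : Generic m a v) {I : Set ℝ} {x u : ℝ → Fin (n + 2) → ℝ} (h : IsSolution m I x)
    (hu : ∀ t ∈ I, ∃ v, VelocityAt x u t v ∧ CollisionLaw m (x t) v (u t)) (h0 : 0 ∈ I)
    (hF : Folded m a v 0 (x 0) (u 0)) (t : ℝ) (ht : t ∈ I) (ht0 : 0 ≤ t) :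
    Folded m a v t (x t) (u t) := by
  refine forall_mem_Icc_of_local (P := fun t => Folded m a v t (x t) (u t)) hF ?_ ?_ t
    ⟨ht0, le_rfl⟩
  · intro s h1 h2 hs
    obtain ⟨v', hv', -⟩ := hu s (h.ordConnected.out h0 ht ⟨h1, h2.le⟩)
    filter_upwards [hv'.right.filter_mono (nhdsWithin_mono s Ioi_subset_Ici_self), hv'.right_vel,
      hs.eventually_right] with r h3 h4 h5
    rwa [h3, h4]
  · intro s h1 h2 hs
    have hsI := h.ordConnected.out h0 ht ⟨h1.le, h2⟩
    obtain ⟨v', hv', hl⟩ := hu s hsI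
    have hgap := gap_nonneg_of_frequently ((h.continuousAt hsI).mono_left nhdsWithin_le_nhds)
      (hs.mono fun r hr => hr.gap_nonneg)
    obtain ⟨r, h3, h4, h5, h6⟩ := (hs.and_eventually (hv'.left_vel.and
      ((hv'.left.filter_mono (nhdsWithin_mono s Iio_subset_Iic_self)).and
        self_mem_nhdsWithin))).exists
    rw [h4, h5] at h3
    obtain ⟨-, w', h7, h8⟩ := h3.exists_outgoing hpair hc hgen h6 hgap
    rwa [hl.unique h7]

/-- If the ordered configurations are confined to a half-cone, there is a bounded solution with
infinitely many collisions. -/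
theorem Confining.exists_infinite (hpair : ∀ i j, i ≠ j → m i + m j ≠ 0)
    (hc : Confining m) (v : Fin (n + 2) → ℝ) (hv : momentum m v = 0)
    (hvpos : 0 < kineticForm m v v) :
    ∃ (I : Set ℝ) (x : ℝ → Fin (n + 2) → ℝ) (C : ℝ), IsSolution m I x ∧
      (∀ t ∈ I, ∀ i, x t i ≤ C) ∧ ¬ (collisionTimes I x).Finite := by
  obtain ⟨a, ha, hgen⟩ := exists_generic hpair v
  have hF0 : Folded m a v 0 a v := Folded.initial ha
  have haff : ∀ s t : ℝ, a + s • v = a + t • v + (s - t) • v := fun s t => by module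
  obtain ⟨ε, hε, hεinj⟩ : ∃ ε : ℝ, 0 < ε ∧ ∀ t ∈ Ioo (-ε) ε,
      Function.Injective (a + t • v) := by
    have h1 : ∀ᶠ t : ℝ in 𝓝 0, ∀ j, 0 < gap j (a + t • v) := eventually_all.2 fun j => by
      have hcont : Continuous fun t : ℝ => gap j (a + t • v) := by
        simp only [map_add, map_smul, smul_eq_mul]
        fun_prop
      have h2 := hcont.tendsto 0
      simp only [zero_smul, add_zero] at h2
      exact h2.eventually (eventually_gt_nhds (ha j))
    obtain ⟨ε, hε, h2⟩ := Metric.eventually_nhds_iff.1 h1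
    exact ⟨ε, hε, fun t ht => injective_of_gap_pos (h2 (by
      rw [Real.dist_eq, sub_zero]; exact abs_lt.2 ht))⟩
  have hsol0 : IsSolution m (Ioo (-ε) ε) fun t => a + t • v :=
    ⟨isOpen_Ioo, ordConnected_Ioo, ⟨0, by simpa using hε⟩,
      fun t ht i j k hij _ _ he => hij (hεinj t ht he.1), fun t ht => ⟨v, v,
        Eventually.of_forall fun s => haff s t, Eventually.of_forall fun s => haff s t,
        CollisionLaw.of_injective (hεinj t ht) v⟩⟩
  obtain ⟨I, x, ⟨hsol, hmax⟩, hεI, hx0⟩ := hsol0.exists_maximal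
  have h0ε : (0 : ℝ) ∈ Ioo (-ε) ε := by simpa using hε
  have h0I : (0 : ℝ) ∈ I := hεI h0ε
  obtain ⟨u, hu⟩ := hsol.exists_velocity
  have hx00 : x 0 = a := by simpa using hx0 h0ε
  have hu0 : u 0 = v := by
    obtain ⟨v', hv', -⟩ := hu 0 h0I
    refine velocity_unique (f := 𝓝[>] 0) (t := 0) (y := x 0) (x := x) ?_
      (hv'.right.filter_mono (nhdsWithin_mono 0 Ioi_subset_Ici_self)) ?_
    · filter_upwards [self_mem_nhdsWithin] with r hr using ne_of_gt hr
    · filter_upwards [mem_nhdsWithin_of_mem_nhds (isOpen_Ioo.mem_nhds h0ε)] with r hr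
      rw [hx0 hr, hx00, sub_zero]
  have hF : ∀ t ∈ I, 0 ≤ t → Folded m a v t (x t) (u t) := fun t ht ht0 =>
    hsol.folded hpair hc hgen hu h0I (by rwa [hx00, hu0]) t ht ht0
  -- The relative energy is nonpositive in the chamber but grows like `t ^ 2 * kineticForm m v v`,
  -- so the motion cannot last forever.
  obtain ⟨T, hT0, hT⟩ : ∃ T : ℝ, 0 ≤ T ∧ ∀ t ∈ I, t ≤ T := by
    have h1 : ∀ t ∈ I, 0 ≤ t →
        relativeEnergy m a + t * (2 * kineticForm m a v + t * kineticForm m v v) ≤ 0 :=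
      fun t ht ht0 => by
        have h2 := hc.relativeEnergy_nonpos (hF t ht ht0).gap_nonneg
        rw [(hF t ht ht0).relativeEnergy_eq hpair hv] at h2
        linarith
    set q := relativeEnergy m a
    set β := kineticForm m a v
    set E := kineticForm m v v
    -- Beyond this time $t>1$ and $2\beta+tE>|q|$, so the quadratic $q+t(2\beta+tE)$ is positive.
    refine ⟨(|q| + 2 * |β|) / E + 1, by positivity, fun t ht => ?_⟩
    by_contra! hcon
    have h3 : (|q| + 2 * |β|) / E < t - 1 := by linarith
    rw [div_lt_iff₀ hvpos] at h3
    have hq0 : 0 ≤ (|q| + 2 * |β|) / E := by positivity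
    have ht1 : 1 < t := by linarith
    have h4 := h1 t ht (by linarith)
    have h5 : |q| < 2 * β + t * E := by nlinarith [neg_abs_le β]
    nlinarith [neg_abs_le q, abs_nonneg q]
  set b := sSup I with hb
  have hbdd : BddAbove I := ⟨T, hT⟩
  have hIb : ∀ t ∈ I, t < b := fun t ht => by
    have h1 : ∀ᶠ r in 𝓝[>] t, r ∈ I := (hsol.mem_nhds ht).filter_mono nhdsWithin_le_nhds
    obtain ⟨r, hr, htr⟩ := (h1.and self_mem_nhdsWithin).exists
    exact lt_of_lt_of_le htr (le_csSup hbdd hr)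
  have hb0 : 0 < b := hIb 0 h0I
  have hmem : Ioo 0 b ⊆ I := fun t ht => by
    obtain ⟨r, hr, htr⟩ := exists_lt_of_lt_csSup ⟨0, h0I⟩ ht.2
    exact hsol.ordConnected.out h0I hr ⟨ht.1.le, htr.le⟩
  have hres : IsSolution m (Ioo 0 b) x :=
    hsol.mono isOpen_Ioo ordConnected_Ioo (nonempty_Ioo.2 hb0) hmem
  obtain ⟨C, hC⟩ := hc.exists_bound (momentum m a) (a 0 - T * |v 0|)
  refine ⟨Ioo 0 b, x, C, hres, fun t ht => ?_, fun hfin => ?_⟩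
  · have hft := hF t (hmem ht) ht.1.le
    refine hC _ hft.gap_nonneg (hft.momentum_eq hv) (le_trans ?_ hft.le_position)
    have h1 : t * |v 0| ≤ T * |v 0| :=
      mul_le_mul_of_nonneg_right (hT t (hmem ht)) (abs_nonneg _)
    have h2 := mul_le_mul_of_nonneg_left (neg_abs_le (v 0)) ht.1.le
    linarith
  -- If there were finitely many collisions, the motion would be straight from the last one up to
  -- `b` and could be continued past `b`, against maximality.
  obtain ⟨c, hc0, hcb, hnc⟩ : ∃ c, 0 ≤ c ∧ c < b ∧
      ∀ t ∈ Ioo c b, t ∉ collisionTimes (Ioo 0 b) x := by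
    rcases (collisionTimes (Ioo 0 b) x).eq_empty_or_nonempty with he | hne
    · exact ⟨0, le_rfl, hb0, fun t _ => by simp [he]⟩
    · obtain ⟨c, hcm, hcmax⟩ := hfin.exists_maximal hne
      refine ⟨c, hcm.1.1.le, hcm.1.2, fun t ht htc => ?_⟩
      exact absurd (hcmax htc ht.1.le) (not_le.2 ht.1)
  have hcI : Ioo c b ⊆ Ioo 0 b := Ioo_subset_Ioo_left hc0
  have hstraight : ∀ t ∈ Ioo c b, VelocityAt x u t (u t) := fun t ht => by
    obtain ⟨v', hv', hl⟩ := hu t (hmem (hcI ht))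
    have : CollisionLaw m (x t) v' v' := by
      refine ⟨fun _ _ => rfl, fun i j _ hij => ?_⟩
      have : v' i = v' j := by
        by_contra hne
        exact hnc t ht ⟨hcI ht, i, j, hij, (eventually_ne_iff_left hij hv'.left).2 hne⟩
      rw [this]
      ring
    rwa [← this.unique hl]
  obtain ⟨e, he⟩ := exists_between hcb
  have hu_const : ∀ t ∈ Ioo c b, u t = u e := fun t ht =>
    eqOn_const_of_locally_const ordConnected_Ioo (fun t ht => (hstraight t ht).left_vel)
      (fun t ht => (hstraight t ht).right_vel) ht he
  have hx_const : ∀ t ∈ Ioo c b, x t - t • u e = x e - e • u e := fun t ht =>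
    eqOn_const_of_locally_const (F := fun t => x t - t • u e) ordConnected_Ioo
      (fun t ht => by
        filter_upwards [(hstraight t ht).left.filter_mono
          (nhdsWithin_mono t Iio_subset_Iic_self)] with s hs
        rw [hs, hu_const t ht]
        module)
      (fun t ht => by
        filter_upwards [(hstraight t ht).right.filter_mono
          (nhdsWithin_mono t Ioi_subset_Ici_self)] with s hs
        rw [hs, hu_const t ht]
        module) ht he
  set q := u e with hq
  obtain ⟨p, hp⟩ : ∃ p, p = x e + (b - e) • q := ⟨_, rfl⟩
  have hxp : ∀ t ∈ Ioo c b, x t = p + (t - b) • q := fun t ht => by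
    rw [sub_eq_iff_eq_add.1 (hx_const t ht), hp]
    module
  have hgap : ∀ j, 0 ≤ gap j p := by
    have hlim : Tendsto (fun t : ℝ => p + (t - b) • q) (𝓝[<] b) (𝓝 p) := by
      have : Continuous fun t : ℝ => p + (t - b) • q := by fun_prop
      simpa using (this.tendsto b).mono_left nhdsWithin_le_nhds
    refine gap_nonneg_of_frequently hlim (Eventually.frequently ?_)
    filter_upwards [Ioo_mem_nhdsLT hcb] with t ht
    rw [← hxp t ht]
    exact (hF t (hmem (hcI ht)) (hcI ht).1.le).gap_nonneg
  have hFe := hF e (hmem (hcI he)) (hcI he).1.le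
  rw [hxp e he] at hFe
  obtain ⟨hone, w, hl, hFw⟩ := hFe.exists_outgoing hpair hc hgen he.2 hgap
  obtain ⟨d, hbd, hd⟩ := mem_nhdsGT_iff_exists_Ioo_subset.1
    (eventually_gap_pos (t := b) hFw.gap_nonneg hFw.gap_pos)
  obtain ⟨J, y, hJ, hIJ, hyx, hbJ⟩ := hsol.exists_continuation hcb hbd hIb
    (hcI.trans hmem) hxp (no_multiple_of_gap hgap hone) hl
    fun t ht => injective_of_gap_pos (hd ht)
  exact lt_irrefl b (hIb b (hmax J y hJ hIJ hyx ▸ hbJ))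

end LineParticles

namespace LineParticles
variable {N : ℕ} {m : Fin N → ℝ}

/-! ### Indefinite kinetic form: infinitely many collisions -/

/-- Some maximal solution has infinitely many collisions. -/
def HasInfiniteCollisions (m : Fin N → ℝ) : Prop :=
  ∃ (I : Set ℝ) (x : ℝ → Fin N → ℝ), IsMaximalSolution m I x ∧ ¬ (collisions I x).Finite

theorem HasInfiniteCollisions.neg_mass (h : HasInfiniteCollisions m) :
    HasInfiniteCollisions (-m) := by
  obtain ⟨I, x, ⟨hx, hmax⟩, hinf⟩ := h
  exact ⟨I, x, ⟨hx.neg_mass, fun J y hy => hmax J y (neg_neg m ▸ hy.neg_mass)⟩, hinf⟩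

theorem totalMass_eq_add_massAbove {n : ℕ} (m : Fin (n + 2) → ℝ) :
    totalMass m = m 0 + massAbove m 0 := by
  rw [← sum_mul_unitStep, totalMass, Fin.sum_univ_succ, Fin.sum_univ_succ (n := n + 1)]
  simp [unitStep]

theorem Confining.hasInfiniteCollisions (hm : ∀ i, m i ≠ 0)
    (hpair : ∀ i j, i ≠ j → m i + m j ≠ 0) {n : ℕ} {σ : Fin (n + 2) → Fin N}
    (hσ : Function.Injective σ) (hc : Confining (m ∘ σ)) : HasInfiniteCollisions m := by
  have hm' : ∀ i, (m ∘ σ) i ≠ 0 := fun i => hm _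
  have hpair' : ∀ i j, i ≠ j → (m ∘ σ) i + (m ∘ σ) j ≠ 0 := fun i j hij => hpair _ _ (hσ.ne hij)
  have hv : momentum (m ∘ σ) (normal (m ∘ σ) 0 1) = 0 := by
    rw [momentum_apply]
    exact normal_mem_zeroMomentum hm' 0 1
  have h01 : (0 : Fin (n + 2)) ≠ 1 := by simp
  have hvpos : 0 < kineticForm (m ∘ σ) (normal (m ∘ σ) 0 1) (normal (m ∘ σ) 0 1) := by
    have h1 := hc.coeff
    have h2 := hc.below 0
    rw [totalMass_eq_add_massAbove] at h2
    rw [kineticForm_normal hm']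
    simp only [normal, Pi.sub_apply, Pi.single_eq_same, Pi.single_eq_of_ne h01,
      Pi.single_eq_of_ne h01.symm]
    rw [collisionCoeff] at h1
    have h3 : (m ∘ σ) 0 < 0 := lt_of_le_of_ne (by linarith) (hm' 0)
    have h4 := hpair' 0 1 h01
    have h5 := hm' 1
    set α := (m ∘ σ) 0
    set β := (m ∘ σ) 1
    -- The normal of the first wall has energy $1/\alpha+1/\beta$. This factorization shows its sign
    -- from $\alpha<0$ and the negative collision coefficient.
    have e : α⁻¹ - 0 - (0 - β⁻¹) = (-α)⁻¹ * (-(2 * β / (α + β))) * ((α + β) / β) ^ 2 / 2 := by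
      have := h3.ne
      field_simp
      ring
    rw [e]
    have h6 : 0 < (-α)⁻¹ := inv_pos.2 (neg_pos.2 h3)
    have h7 : 0 < -(2 * β / (α + β)) := neg_pos.2 h1
    have h8 : (α + β) / β ≠ 0 := div_ne_zero h4 h5
    positivity
  obtain ⟨I, x, C, hx, hC, hinf⟩ := hc.exists_infinite hpair' _ hv hvpos
  obtain ⟨y, hy, hyx⟩ := hx.exists_extend hσ hC
  obtain ⟨J, z, hz, hIJ, hzy⟩ := hy.exists_maximal
  refine ⟨J, z, hz, fun hfin => hinf ?_⟩
  exact ((finite_collisions_iff.1 hfin).subset (collisionTimes_mono hy.isOpen hIJ hzy)).subset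
    (collisionTimes_subset_of_comp hyx)

theorem confining_three {a b c : ℝ} (ha : 0 < b) (hac : b < a) (hbc : b < c) :
    Confining (n := 1) ![-a, b, -c] := by
  have e0 : unitStep (n := 1) 0 = ![0, 1, 1] := by
    ext i
    fin_cases i
    exacts [if_neg (by decide), if_pos (by decide), if_pos (by decide)]
  have e1 : unitStep (n := 1) 1 = ![0, 0, 1] := by
    ext i
    fin_cases i
    exacts [if_neg (by decide), if_neg (by decide), if_pos (by decide)]
  have h0 : massAbove (n := 1) ![-a, b, -c] 0 = b - c := by
    rw [← sum_mul_unitStep, e0, Fin.sum_univ_three]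
    simp
    ring
  have h1 : massAbove (n := 1) ![-a, b, -c] 1 = -c := by
    rw [← sum_mul_unitStep, e1, Fin.sum_univ_three]
    simp
  have hM : totalMass (N := 1 + 2) ![-a, b, -c] = b - a - c := by
    rw [totalMass_eq_add_massAbove, h0]
    simp
    ring
  refine ⟨fun j => ?_, fun j => ?_, ?_⟩
  · fin_cases j
    · simp only [Fin.zero_eta, h0, hM]; nlinarith
    · simp only [Fin.mk_one, h1, hM]; nlinarith
  · fin_cases j
    · simp only [Fin.zero_eta, h0, hM]; linarith
    · simp only [Fin.mk_one, h1, hM]; linarith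
  · change 2 * b / (-a + b) < 0
    exact div_neg_of_pos_of_neg (by linarith) (by linarith)

/-- If some positive mass is lighter than $|m_{i_0}|$, the order `i₀`, that particle, further
positive ones is confining. Otherwise `i₀` placed between two heavier particles is confining after
changing all signs. -/
theorem hasInfiniteCollisions_of_sum_lt (hm : ∀ i, m i ≠ 0)
    (hpair : ∀ i j, i ≠ j → m i + m j ≠ 0) {i₀ : Fin N} (hi₀ : m i₀ < 0) {S : Finset (Fin N)}
    (hS : ∀ j ∈ S, 0 < m j) (hcard : 1 < S.card) (hsum : -m i₀ < ∑ j ∈ S, m j) :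
    HasInfiniteCollisions m := by
  classical
  have hne : ∀ j, 0 < m j → j ≠ i₀ := fun j hj e => by rw [e] at hj; linarith
  by_cases hlt : ∃ j₁ ∈ S, m j₁ < -m i₀
  · obtain ⟨j₁, hj₁S, hj₁⟩ := hlt
    -- Minimality gives the condition `below`: removing the particles above a gap other than the
    -- first leaves at most $|m_{i_0}|$, so those particles weigh at least the total mass.
    obtain ⟨T, ⟨hTS, hj₁T, hTsum⟩, hTmin⟩ :=
      Set.Finite.exists_minimal (s := {T : Finset (Fin N) | T ⊆ S ∧ j₁ ∈ T ∧ -m i₀ < ∑ j ∈ T, m j})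
        (Set.toFinite _) ⟨S, Finset.Subset.refl S, hj₁S, hsum⟩
    let e := (T.erase j₁).equivFin.symm
    let σ : Fin ((T.erase j₁).card + 2) → Fin N :=
      Fin.cons i₀ (Fin.cons j₁ fun i => (e i : Fin N))
    have hσ0 : σ 0 = i₀ := rfl
    have hσ1 : σ 1 = j₁ := rfl
    have hT' : ∀ i : Fin ((T.erase j₁).card + 1), σ i.succ ∈ T := fun i => by
      refine Fin.cases hj₁T (fun k => ?_) i
      exact Finset.mem_of_mem_erase (e k).2
    have hpos : ∀ i : Fin ((T.erase j₁).card + 1), 0 < m (σ i.succ) := fun i => hS _ (hTS (hT' i))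
    have hσ : Function.Injective σ := by
      refine Fin.cons_injective_iff.2 ⟨?_, Fin.cons_injective_iff.2 ⟨?_, ?_⟩⟩
      · rintro ⟨i, hi⟩
        exact hne _ (hpos i) hi
      · rintro ⟨i, hi⟩
        exact Finset.ne_of_mem_erase (e i).2 hi
      · exact Subtype.val_injective.comp e.injective
    have hM : totalMass (m ∘ σ) = m i₀ + ∑ j ∈ T, m j := by
      rw [totalMass, Fin.sum_univ_succ, Fin.sum_univ_succ, ← Finset.add_sum_erase T m hj₁T]
      congr 2
      rw [← Finset.sum_coe_sort (T.erase j₁) m]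
      exact Equiv.sum_comp e fun j => m j
    have hposIoi : ∀ j, ∀ i ∈ Finset.Ioi (Fin.castSucc j), 0 < (m ∘ σ) i ∧ σ i ∈ T := by
      intro j i hi
      have h0 : i ≠ 0 := (lt_of_le_of_lt (Fin.zero_le _) (Finset.mem_Ioi.1 hi)).ne'
      obtain ⟨k, rfl⟩ := Fin.exists_succ_eq.2 h0
      exact ⟨hpos k, hT' k⟩
    have habove : ∀ j, 0 < massAbove (m ∘ σ) j := fun j =>
      Finset.sum_pos (fun i hi => (hposIoi j i hi).1)
        ⟨j.succ, Finset.mem_Ioi.2 j.castSucc_lt_succ⟩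
    refine Confining.hasInfiniteCollisions hm hpair hσ ⟨fun j => ?_, fun j => ?_, ?_⟩
    · exact mul_pos (habove j) (by rw [hM]; linarith)
    · rcases eq_or_ne j 0 with rfl | hj
      · rw [totalMass_eq_add_massAbove, Function.comp_apply, hσ0]
        linarith
      · let G := (Finset.Ioi j.castSucc).image σ
        have hGT : G ⊆ T := Finset.image_subset_iff.2 fun i hi => (hposIoi j i hi).2
        have hGsum : ∑ i ∈ G, m i = massAbove (m ∘ σ) j := Finset.sum_image hσ.injOn
        have h1 := Finset.sum_sdiff (f := m) hGT
        have hj₁G : j₁ ∉ G := fun h => by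
          obtain ⟨i, hi, he⟩ := Finset.mem_image.1 h
          have : i = 1 := hσ (he.trans hσ1.symm)
          rw [this, Finset.mem_Ioi, Fin.lt_def, Fin.val_castSucc, Fin.val_one] at hi
          exact hj (Fin.ext (by simpa using hi))
        have hle : ¬ (-m i₀ < ∑ i ∈ T \ G, m i) := fun h => by
          have h2 := hTmin ⟨Finset.sdiff_subset.trans hTS, Finset.mem_sdiff.2 ⟨hj₁T, hj₁G⟩, h⟩
            Finset.sdiff_subset
          have h3 : σ j.succ ∈ G :=
            Finset.mem_image_of_mem _ (Finset.mem_Ioi.2 j.castSucc_lt_succ)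
          exact (Finset.mem_sdiff.1 (h2 (hGT h3))).2 h3
        rw [hM]
        linarith
    · change 2 * m j₁ / (m i₀ + m j₁) < 0
      exact div_neg_of_pos_of_neg (by linarith [hS j₁ hj₁S]) (by linarith)
  · push Not at hlt
    obtain ⟨a, ha, b, hb, hab⟩ := Finset.one_lt_card.1 hcard
    have hlt' : ∀ j ∈ S, -m i₀ < m j := fun j hj => lt_of_le_of_ne (hlt j hj) fun h =>
      hpair i₀ j (hne j (hS j hj)).symm (by linarith)
    have hσ : Function.Injective ![a, i₀, b] := by
      have h1 := hne a (hS a ha)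
      have h2 := hne b (hS b hb)
      intro i j hij
      fin_cases i <;> fin_cases j <;> simp [hab, hab.symm, h1, h2, h1.symm, h2.symm] at hij ⊢
    have hc : Confining (n := 1) ((-m) ∘ ![a, i₀, b]) := by
      have := confining_three (a := m a) (b := -m i₀) (c := m b) (by linarith)
        (hlt' a ha) (hlt' b hb)
      convert this using 1
      ext i
      fin_cases i <;> simp
    have := hc.hasInfiniteCollisions (m := -m) (fun i => neg_ne_zero.2 (hm i))
      (fun i j hij => by
        have := hpair i j hij
        simp only [Pi.neg_apply]
        intro h
        exact this (by linarith)) hσ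
    simpa using this.neg_mass

/-! ### Masses for which the form is definite -/

theorem isDefinite_neg (h : IsDefinite ((kineticForm m).restrict (zeroMomentum m))) :
    IsDefinite ((kineticForm (-m)).restrict (zeroMomentum (-m))) := by
  rw [isDefinite_iff] at h ⊢
  simpa only [mem_zeroMomentum_neg, kineticForm_neg, neg_pos, neg_lt_zero] using h.symm

theorem kineticForm_pos_of_forall_pos (h : ∀ i, 0 < m i) {y : Fin N → ℝ} (hy : y ≠ 0) :
    0 < kineticForm m y y := by
  obtain ⟨j, hj⟩ := Function.ne_iff.1 hy
  rw [kineticForm_apply]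
  refine Finset.sum_pos' (fun i _ => ?_) ⟨j, Finset.mem_univ j, ?_⟩
  · have := mul_nonneg (h i).le (mul_self_nonneg (y i))
    linarith
  · have := mul_pos (h j) (mul_self_pos.2 hj)
    linarith

/-- On $P_0$ the entry $y_i$ is determined by the others, and Cauchy–Schwarz bounds its negative
energy by theirs times $\sum_{j\ne i}m_j/|m_i|<1$. -/
theorem kineticForm_pos_of_totalMass_neg {i : Fin N} (hi : m i < 0) (h : ∀ j, j ≠ i → 0 < m j)
    (hM : totalMass m < 0) {y : Fin N → ℝ} (hy0 : y ∈ zeroMomentum m) (hy : y ≠ 0) :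
    0 < kineticForm m y y := by
  have hpos : ∀ j ∈ Finset.univ.erase i, 0 < m j := fun j hj => h j (Finset.ne_of_mem_erase hj)
  rw [totalMass, ← Finset.add_sum_erase _ _ (Finset.mem_univ i)] at hM
  rw [mem_zeroMomentum, ← Finset.add_sum_erase _ _ (Finset.mem_univ i)] at hy0
  rw [kineticForm_apply, ← Finset.add_sum_erase _ _ (Finset.mem_univ i)]
  have hcs := Finset.sum_sq_le_sum_mul_sum_of_sq_le_mul (Finset.univ.erase i) (f := m)
    (g := fun j => y j * m j * y j) (r := fun j => m j * y j) (fun j hj => (hpos j hj).le)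
    (fun j hj => by
      have := mul_nonneg (hpos j hj).le (mul_self_nonneg (y j))
      linarith) (fun j _ => le_of_eq (by ring))
  have hS : 0 < ∑ j ∈ Finset.univ.erase i, y j * m j * y j := by
    obtain ⟨j, hj, hyj⟩ : ∃ j, j ≠ i ∧ y j ≠ 0 := by
      by_contra! hcon
      have h1 : ∑ j ∈ Finset.univ.erase i, m j * y j = 0 := Finset.sum_eq_zero fun j hj => by
        rw [hcon j (Finset.ne_of_mem_erase hj), mul_zero]
      rw [h1, add_zero] at hy0
      have h2 : y i = 0 := (mul_eq_zero.1 hy0).resolve_left hi.ne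
      exact hy (funext fun j => by
        rcases eq_or_ne j i with rfl | hj
        · exact h2
        · exact hcon j hj)
    refine Finset.sum_pos' (fun k hk => ?_)
      ⟨j, Finset.mem_erase.2 ⟨hj, Finset.mem_univ j⟩, ?_⟩
    · have := mul_nonneg (hpos k hk).le (mul_self_nonneg (y k))
      linarith
    · have := mul_pos (h j hj) (mul_self_pos.2 hyj)
      linarith
  set P := ∑ j ∈ Finset.univ.erase i, m j
  set s := ∑ j ∈ Finset.univ.erase i, y j * m j * y j
  set L := ∑ j ∈ Finset.univ.erase i, m j * y j
  have hL : L = -(m i * y i) := by linarith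
  rw [hL] at hcs
  have h1 : 0 < (-m i - P) * s := mul_pos (by linarith) hS
  have h2 : 0 < (-m i) * (y i * m i * y i + s) := by nlinarith
  exact (mul_pos_iff_of_pos_left (by linarith)).1 h2

theorem isDefinite_of_card_neg_le_one (hm : ∀ i, m i ≠ 0) (hM : totalMass m ≠ 0)
    (hcard : (Finset.univ.filter fun i => m i < 0).card ≤ 1)
    (hsum : ∀ i, m i < 0 → ∑ j with 0 < m j, m j ≤ -m i) :
    IsDefinite ((kineticForm m).restrict (zeroMomentum m)) := by
  refine isDefinite_iff.2 (Or.inl fun y hy0 hy => ?_)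
  by_cases hneg : ∃ i, m i < 0
  · obtain ⟨i, hi⟩ := hneg
    have hpos : ∀ j, j ≠ i → 0 < m j := fun j hj => by
      by_contra hcon
      have hj' : m j < 0 := lt_of_le_of_ne (not_lt.1 hcon) (hm j)
      exact hj (Finset.card_le_one.1 hcard j (by simpa) i (by simpa))
    refine kineticForm_pos_of_totalMass_neg hi hpos (lt_of_le_of_ne ?_ hM) hy0 hy
    have he : (Finset.univ.filter fun j => 0 < m j) = Finset.univ.erase i := by
      ext j
      simp only [Finset.mem_filter, Finset.mem_univ, true_and, Finset.mem_erase, and_true]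
      exact ⟨fun h e => by rw [e] at h; linarith, hpos j⟩
    have := hsum i hi
    rw [he] at this
    rw [totalMass, ← Finset.add_sum_erase _ _ (Finset.mem_univ i)]
    linarith
  · push Not at hneg
    exact kineticForm_pos_of_forall_pos (fun i => lt_of_le_of_ne (hneg i) (hm i).symm) hy

/-- Two masses of each sign are impossible: with $P$ the sum of the positive masses, each negative
one has size at least $P$, so together at least $2P$, yet `h2` bounds them by one positive mass. So
one sign occurs at most once. -/
theorem isDefinite_of_forall_sum_le (hN : 3 ≤ N) (hm : ∀ i, m i ≠ 0) (hM : totalMass m ≠ 0)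
    (h1 : ∀ i, m i < 0 → 1 < (Finset.univ.filter fun j => 0 < m j).card →
      ∑ j with 0 < m j, m j ≤ -m i)
    (h2 : ∀ i, 0 < m i → 1 < (Finset.univ.filter fun j => m j < 0).card →
      ∑ j with m j < 0, -m j ≤ m i) :
    IsDefinite ((kineticForm m).restrict (zeroMomentum m)) := by
  have hcard : (Finset.univ.filter fun j => 0 < m j).card +
      (Finset.univ.filter fun j => m j < 0).card = N := by
    have e : (Finset.univ.filter fun j => m j < 0) = Finset.univ.filter fun j => ¬ 0 < m j := by
      ext j
      simp only [Finset.mem_filter, Finset.mem_univ, true_and, not_lt]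
      exact ⟨le_of_lt, fun h => lt_of_le_of_ne h (hm j)⟩
    rw [e, Finset.card_filter_add_card_filter_not, Finset.card_univ, Fintype.card_fin]
  rcases Nat.lt_or_ge 1 (Finset.univ.filter fun j => m j < 0).card with hn | hn
  · rcases Nat.lt_or_ge 1 (Finset.univ.filter fun j => 0 < m j).card with hp | hp
    · exfalso
      obtain ⟨i, hi⟩ := Finset.card_pos.1 (zero_lt_one.trans hp)
      have hi0 : 0 < m i := (Finset.mem_filter.1 hi).2
      have h3 : m i ≤ ∑ j with 0 < m j, m j :=
        Finset.single_le_sum (fun j hj => (Finset.mem_filter.1 hj).2.le) hi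
      have h4 := Finset.card_nsmul_le_sum (Finset.univ.filter fun j => m j < 0)
        (fun j => -m j) (∑ j with 0 < m j, m j) fun j hj => h1 j (Finset.mem_filter.1 hj).2 hp
      have h5 := h2 i hi0 hn
      rw [nsmul_eq_mul] at h4
      have h6 : (2 : ℝ) ≤ (Finset.univ.filter fun j => m j < 0).card := by exact_mod_cast hn
      nlinarith
    · have := isDefinite_of_card_neg_le_one (m := -m) (fun i => neg_ne_zero.2 (hm i))
        (by simpa [totalMass] using hM) (by simpa using hp)
        (fun i hi => by simpa using h2 i (by simpa using hi) hn)
      exact neg_neg m ▸ isDefinite_neg this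
  · exact isDefinite_of_card_neg_le_one hm hM hn fun i hi => h1 i hi (by omega)

theorem hasInfiniteCollisions_of_not_isDefinite (hN : 3 ≤ N) (hm : ∀ i, m i ≠ 0)
    (hpair : ∀ i j, i ≠ j → m i + m j ≠ 0) (hM : totalMass m ≠ 0)
    (hdef : ¬ IsDefinite ((kineticForm m).restrict (zeroMomentum m))) :
    HasInfiniteCollisions m := by
  by_contra hcon
  refine hdef (isDefinite_of_forall_sum_le hN hm hM (fun i hi hc => ?_) fun i hi hc => ?_)
  · by_contra! hlt
    exact hcon (hasInfiniteCollisions_of_sum_lt hm hpair hi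
      (fun j hj => (Finset.mem_filter.1 hj).2) hc hlt)
  · by_contra! hlt
    refine hcon ?_
    have := hasInfiniteCollisions_of_sum_lt (m := -m) (fun i => neg_ne_zero.2 (hm i))
      (fun i j hij h => hpair i j hij (by simp only [Pi.neg_apply] at h; linarith)) (i₀ := i)
      (by simpa using hi) (S := Finset.univ.filter fun j => m j < 0)
      (fun j hj => by simpa using hj) hc (by simpa using hlt)
    simpa using this.neg_mass

end LineParticles

theorem mainTheorem1 (N : ℕ) (hN : 3 ≤ N) (m : Fin N → ℝ)
    (hm : ∀ i, m i ≠ 0) (hpair : ∀ i j, i ≠ j → m i + m j ≠ 0) :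
    LineParticles.IsDefinite
        ((LineParticles.kineticForm m).restrict (LineParticles.zeroMomentum m)) ↔
      (LineParticles.totalMass m ≠ 0 ∧
        ∀ (I : Set ℝ) (x : ℝ → Fin N → ℝ), LineParticles.IsMaximalSolution m I x →
          (LineParticles.collisions I x).Finite) := by
  constructor
  · intro hdef
    exact ⟨LineParticles.totalMass_ne_zero_of_isDefinite (by omega) hdef, fun I x hx =>
      LineParticles.finite_collisions_of_isDefinite hm hpair hdef hx.1⟩
  · rintro ⟨hM, hfin⟩
    by_contra hdef
    obtain ⟨I, x, hx, hinf⟩ :=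
      LineParticles.hasInfiniteCollisions_of_not_isDefinite hN hm hpair hM hdef
    exact hinf (hfin I x hx)
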